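/- Let $k$ be an algebraically closed field, let $N$ be a lattice (a free abelian group of finite rank) with dual lattice $M=\operatorname{Hom}(N,\mathbb{Z})$, and let $\Delta$ be a fan in $N$, that is, a finite nonempty collection of strongly convex rational polyhedral cones in $N_{\mathbb{R}}=N\otimes_{\mathbb Z}\mathbb{R}$ that is closed under taking faces and in which any two cones intersect along a common face. Assume that $\Delta$ is non-degenerate, i.e. not contained in a proper subspace of $N_{\mathbb{R}}$. Let $X=X(\Delta)$ be the toric variety over $k$ glued from the affine charts $U_\sigma=\operatorname{Spec} k[\sigma^\vee\cap M]$, $\sigma\in\Delta$, along the open subschemes $U_{\sigma\cap\tau}$, and let $T=\operatorname{Spec} k[M]$ be its torus. For $u\in M$ let $x^u$ be the corresponding character, regarded as a rational function on $X$. Let $v_1,\dots,v_d\in N$ be the primitive generators of the rays of $\Delta$, and for each $i$ let $Y(v_i)$ be the prime divisor of $X$ whose ideal in the chart of the ray spanned by $v_i$ is generated by the $x^u$ with $\langle u,v_i\rangle>0$. Let $\operatorname{Cl}(X)$ be the group of Weil divisors modulo principal divisors, and let $\operatorname{Cox}(X)=k[v_1,\dots,v_d]$ be the polynomial ring with one variable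 for each ray, graded by $\operatorname{Cl}(X)$ via $\deg(v_i)=[Y(v_i)]$. Let $D$ be a $T$-invariant Weil divisor on $X$, let $a_i$ be the coefficient of $Y(v_i)$ in $D$, and let $$H^0(X,\mathcal O(D))=\{f\in k(X)\;:\; f=0\ \text{ or }\ \operatorname{div}(f)+D\ge 0\}$$ be the space of global sections of the sheaf associated to $D$. Then $H^0(X,\mathcal O(D))$ is isomorphic, as a $k$-vector space, to the graded piece $\operatorname{Cox}(X)_{[D]}$ of degree $[D]\in\operatorname{Cl}(X)$. More precisely, there is a unique $k$-linear isomorphism $$H^0(X,\mathcal O(D))\;\longrightarrow\;\operatorname{Cox}(X)_{[D]}$$ that sends every character $x^u$ ($u\in M$) with $\operatorname{div}(x^u)+D\ge 0$ to the monomial $\prod_{i=1}^d v_i^{\langle u,v_i\rangle+a_i}$, all of whose exponents are nonnegative. -/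

import Mathlib

noncomputable section

namespace Toric

open CategoryTheory CategoryTheory.Limits AlgebraicGeometry
open scoped TensorProduct

universe u


section Cones

variable (N : Type) [AddCommGroup N]

/-- `N_ℝ = ℝ ⊗ N`. -/
abbrev RealSpan : Type := ℝ ⊗[ℤ] N

/-- The dual lattice `M = Hom(N, ℤ)`. -/
abbrev DualLattice : Type := Module.Dual ℤ N

variable {N}

/-- The image of a lattice vector in `N_ℝ`. -/
def toReal (v : N) : RealSpan N := (1 : ℝ) ⊗ₜ[ℤ] v

/-- The real linear functional on `N_ℝ` that extends `u ∈ M`. -/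
def realFunctional (u : DualLattice N) : RealSpan N →ₗ[ℝ] ℝ :=
  Module.Dual.baseChange ℝ u

/-- The rational polyhedral cones: positive spans of finitely many lattice vectors. -/
def IsRationalPolyhedral (σ : PointedCone ℝ (RealSpan N)) : Prop :=
  ∃ S : Finset N, σ = PointedCone.hull ℝ (toReal '' (S : Set N))

/-- `τ` is the face of `σ` cut out by a supporting hyperplane `w = 0`; `w = 0` is allowed, so that
a cone is a face of itself. -/
def IsFace (τ σ : PointedCone ℝ (RealSpan N)) : Prop :=
  ∃ w : RealSpan N →ₗ[ℝ] ℝ, (∀ x ∈ σ, 0 ≤ w x) ∧ ∀ x, x ∈ τ ↔ x ∈ σ ∧ w x = 0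

/-- The semigroup `σ^∨ ∩ M`. -/
def dualMonoid (σ : PointedCone ℝ (RealSpan N)) : AddSubmonoid (DualLattice N) where
  carrier := {u | ∀ x ∈ σ, 0 ≤ realFunctional u x}
  zero_mem' := by intro x _; simp [realFunctional]
  add_mem' := by
    intro a b ha hb x hx
    have h : realFunctional (a + b) x = realFunctional a x + realFunctional b x := by
      simp [realFunctional]
    rw [h]; exact add_nonneg (ha x hx) (hb x hx)

variable (N) in
/-- A fan in the lattice `N`: a finite collection of rational polyhedral cones which is closed under
taking faces and in which any two cones meet along a common face. The condition `{0} ∈ Δ` says that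
the fan is nonempty and that its cones are strongly convex, i.e. contain no line. -/
structure Fan where
  cones : Set (PointedCone ℝ (RealSpan N))
  finite : cones.Finite
  bot_mem : ⊥ ∈ cones
  rational : ∀ σ ∈ cones, IsRationalPolyhedral σ
  face_mem : ∀ σ ∈ cones, ∀ τ, IsFace τ σ → τ ∈ cones
  inter_face : ∀ σ ∈ cones, ∀ τ ∈ cones, IsFace (σ ⊓ τ) σ ∧ IsFace (σ ⊓ τ) τ

/-- The fan is not contained in a proper subspace of `N_ℝ`. -/
def Fan.IsNondegenerate (Δ : Fan N) : Prop :=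
  Submodule.span ℝ (⋃ σ ∈ Δ.cones, (σ : Set (RealSpan N))) = ⊤

@[simp] lemma realFunctional_toReal (u : DualLattice N) (v : N) :
    realFunctional u (toReal v) = (u v : ℝ) := by
  simp [realFunctional, toReal]

lemma realFunctional_add (u w : DualLattice N) (x : RealSpan N) :
    realFunctional (u + w) x = realFunctional u x + realFunctional w x := by
  simp [realFunctional]

lemma realFunctional_nsmul (n : ℕ) (u : DualLattice N) (x : RealSpan N) :
    realFunctional (n • u) x = n * realFunctional u x := by
  induction n with
  | zero => simp [realFunctional]
  | succ n ih => rw [succ_nsmul, realFunctional_add, ih]; push_cast; ring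

lemma nonneg_on_hull {S : Set N} {w : RealSpan N →ₗ[ℝ] ℝ}
    (h : ∀ s ∈ S, 0 ≤ w (toReal s)) :
    ∀ x ∈ PointedCone.hull ℝ (toReal '' S), 0 ≤ w x := by
  intro x hx
  induction hx using Submodule.span_induction with
  | mem x hx => obtain ⟨s, hs, rfl⟩ := hx; exact h s hs
  | zero => simp
  | add x y _ _ hx hy => rw [map_add]; exact add_nonneg hx hy
  | smul a x _ hx =>
    rw [LinearMap.map_smul_of_tower]
    exact smul_nonneg a.2 hx

lemma toReal_mem_hull {S : Set N} {s : N} (hs : s ∈ S) :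
    toReal s ∈ PointedCone.hull ℝ (toReal '' S) :=
  Submodule.subset_span ⟨s, hs, rfl⟩

lemma mem_dualMonoid_hull {S : Set N} {u : DualLattice N} :
    u ∈ dualMonoid (PointedCone.hull ℝ (toReal '' S)) ↔ ∀ s ∈ S, 0 ≤ u s := by
  constructor
  · intro h s hs
    have := h _ (toReal_mem_hull hs)
    rw [realFunctional_toReal] at this
    exact_mod_cast this
  · intro h
    apply nonneg_on_hull
    intro s hs
    rw [realFunctional_toReal]
    exact_mod_cast h s hs

/-- A point of the hull on which a nonnegative functional vanishes is in the hull of those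
generators on which it vanishes. -/
lemma mem_hull_of_eq_zero {S : Set N} {w : RealSpan N →ₗ[ℝ] ℝ}
    (h : ∀ s ∈ S, 0 ≤ w (toReal s)) :
    ∀ x ∈ PointedCone.hull ℝ (toReal '' S), w x = 0 →
      x ∈ PointedCone.hull ℝ (toReal '' {s ∈ S | w (toReal s) = 0}) := by
  intro x hx
  induction hx using Submodule.span_induction with
  | mem x hx => obtain ⟨s, hs, rfl⟩ := hx; intro h0; exact toReal_mem_hull ⟨hs, h0⟩
  | zero => intro _; exact zero_mem _
  | add x y hx' hy' hx hy =>
    intro h0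
    rw [map_add] at h0
    have h1 := nonneg_on_hull h x hx'
    have h2 := nonneg_on_hull h y hy'
    exact add_mem (hx (by linarith)) (hy (by linarith))
  | smul a x hx' hx =>
    intro h0
    rw [LinearMap.map_smul_of_tower] at h0
    by_cases ha : a = 0
    · subst ha; rw [zero_smul]; exact zero_mem _
    · apply Submodule.smul_mem
      apply hx
      have : (a : ℝ) * w x = 0 := h0
      rcases mul_eq_zero.1 this with h | h
      · exact absurd (Subtype.ext h) ha
      · exact h

/-- A functional with rational signs: there is a lattice functional with the same sign on each of
finitely many lattice vectors on which the given real functional is nonnegative. -/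
lemma exists_integral_functional [Module.Finite ℤ N] (S : Finset N) (w : RealSpan N →ₗ[ℝ] ℝ)
    (h : ∀ s ∈ S, 0 ≤ w (toReal s)) :
    ∃ u : DualLattice N, (∀ s ∈ S, 0 ≤ u s) ∧ ∀ s ∈ S, u s = 0 ↔ w (toReal s) = 0 := by
  classical
  let f : N →ₗ[ℤ] ℝ := (w.restrictScalars ℤ) ∘ₗ (TensorProduct.mk ℤ ℝ N 1)
  have hf : ∀ s, f s = w (toReal s) := fun s => rfl
  let A := LinearMap.range f
  have : Module.Finite ℤ A := Module.Finite.range f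
  let b := Module.Free.chooseBasis ℤ A
  let ι := Module.Free.ChooseBasisIndex ℤ A
  let c : ι → DualLattice N := fun j => b.coord j ∘ₗ f.rangeRestrict
  have hc : ∀ s, f s = ∑ j, (c j s : ℝ) * (b j : ℝ) := by
    intro s
    have := congrArg (Subtype.val) (b.sum_repr (f.rangeRestrict s))
    simp only [AddSubmonoidClass.coe_finsetSum] at this
    rw [show f s = ((f.rangeRestrict s : A) : ℝ) from rfl, ← this]
    simp [c, zsmul_eq_mul, ι]
  have hc0 : ∀ s, f s = 0 → ∀ j, c j s = 0 := by
    intro s hs j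
    have : f.rangeRestrict s = 0 := Subtype.ext hs
    simp [c, this]
  let O : Set (ι → ℝ) := ⋂ s ∈ S.filter (fun s => 0 < f s), {q | 0 < ∑ j, (c j s : ℝ) * q j}
  have hO : IsOpen O := by
    apply isOpen_biInter_finset
    intro s _
    exact isOpen_lt continuous_const (by fun_prop)
  have hne : (fun j => (b j : ℝ)) ∈ O := by
    simp only [O, Set.mem_iInter, Finset.mem_filter]
    rintro s ⟨_, hs⟩
    change 0 < ∑ j, (c j s : ℝ) * (b j : ℝ)
    rw [← hc]; exact hs
  have hd : DenseRange (Pi.map (fun (_ : ι) (x : ℚ) => (x : ℝ))) :=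
    DenseRange.piMap (fun _ => Rat.denseRange_cast)
  obtain ⟨q, hq⟩ := hd.exists_mem_open hO ⟨_, hne⟩
  let d : ℤ := ∏ j, ((q j).den : ℤ)
  have hdpos : 0 < d := Finset.prod_pos fun j _ => by exact_mod_cast (q j).den_pos
  have hn : ∀ j, ∃ n : ℤ, (n : ℝ) = d * (q j : ℝ) := by
    intro j
    obtain ⟨e, he⟩ : ((q j).den : ℤ) ∣ d := Finset.dvd_prod_of_mem _ (Finset.mem_univ j)
    refine ⟨e * (q j).num, ?_⟩
    have h1 : (q j : ℝ) * ((q j).den : ℝ) = (q j).num := by exact_mod_cast Rat.mul_den_eq_num (q j)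
    rw [he]; push_cast; rw [← h1]; ring
  choose n hn using hn
  let u : DualLattice N := ∑ j, n j • c j
  have hu : ∀ s, (u s : ℝ) = d * ∑ j, (c j s : ℝ) * (q j : ℝ) := by
    intro s
    simp only [u, LinearMap.sum_apply, LinearMap.smul_apply, smul_eq_mul, Int.cast_sum,
      Int.cast_mul, hn, Finset.mul_sum]
    exact Finset.sum_congr rfl fun j _ => by ring
  have hpos : ∀ s ∈ S, 0 < f s → 0 < u s := by
    intro s hs h0
    have h1 : 0 < ∑ j, (c j s : ℝ) * (q j : ℝ) := by
      simp only [O, Set.mem_iInter, Finset.mem_filter] at hq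
      exact hq s ⟨hs, h0⟩
    have : (0 : ℝ) < u s := by rw [hu]; exact mul_pos (by exact_mod_cast hdpos) h1
    exact_mod_cast this
  have hzero : ∀ s, f s = 0 → u s = 0 := by
    intro s hs
    simp [u, hc0 s hs]
  refine ⟨u, fun s hs => ?_, fun s hs => ⟨fun h0 => ?_, fun h0 => hzero s h0⟩⟩
  · rcases (h s hs).eq_or_lt with h0 | h0
    · exact (hzero s h0.symm).ge
    · exact (hpos s hs h0).le
  · by_contra h1
    have := hpos s hs (lt_of_le_of_ne (h s hs) (Ne.symm h1))
    omega

/-- A face of a rational polyhedral cone is cut out by an element of the dual semigroup. -/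
lemma IsFace.exists_dual [Module.Finite ℤ N] {τ σ : PointedCone ℝ (RealSpan N)}
    (hσ : IsRationalPolyhedral σ) (h : IsFace τ σ) :
    ∃ u ∈ dualMonoid σ, ∀ x, x ∈ τ ↔ x ∈ σ ∧ realFunctional u x = 0 := by
  obtain ⟨S, rfl⟩ := hσ
  obtain ⟨w, hw, hτ⟩ := h
  have hwS : ∀ s ∈ S, 0 ≤ w (toReal s) := fun s hs => hw _ (toReal_mem_hull hs)
  obtain ⟨u, hu, hu0⟩ := exists_integral_functional S w hwS
  have huS : ∀ s ∈ (S : Set N), 0 ≤ realFunctional u (toReal s) := fun s hs => by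
    rw [realFunctional_toReal]; exact_mod_cast hu s hs
  refine ⟨u, mem_dualMonoid_hull.2 hu, fun x => ?_⟩
  rw [hτ]
  have hset : {s ∈ (S : Set N) | w (toReal s) = 0} =
      {s ∈ (S : Set N) | realFunctional u (toReal s) = 0} := by
    ext s
    simp only [Set.mem_ofPred_eq, and_congr_right_iff, realFunctional_toReal, Int.cast_eq_zero]
    exact fun hs => (hu0 s hs).symm
  have key : ∀ w' : RealSpan N →ₗ[ℝ] ℝ, (∀ s ∈ (S : Set N), 0 ≤ w' (toReal s)) → ∀ x,
      (x ∈ PointedCone.hull ℝ (toReal '' (S : Set N)) ∧ w' x = 0 ↔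
        x ∈ PointedCone.hull ℝ (toReal '' {s ∈ (S : Set N) | w' (toReal s) = 0})) := by
    intro w' hw' x
    refine ⟨fun hx => mem_hull_of_eq_zero hw' x hx.1 hx.2, fun hx => ⟨?_, ?_⟩⟩
    · exact Submodule.span_mono (Set.image_mono (Set.sep_subset _ _)) hx
    · apply le_antisymm
      · have := nonneg_on_hull (w := -w') (fun s hs => by
          rw [LinearMap.neg_apply, hs.2, neg_zero]) x hx
        simpa using this
      · exact nonneg_on_hull (w := w') (fun s hs => hs.2.ge) x hx
  rw [key w hwS, key (realFunctional u) huS, hset]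

lemma dualMonoid_anti {τ σ : PointedCone ℝ (RealSpan N)} (h : τ ≤ σ) :
    dualMonoid σ ≤ dualMonoid τ :=
  fun _ hu x hx => hu x (h hx)

/-- If `τ` is the face of `σ` cut out by `w`, then `τ^∨ ∩ M = σ^∨ ∩ M + ℕ (-w)`. -/
lemma exists_add_nsmul_mem {τ σ : PointedCone ℝ (RealSpan N)}
    (hσ : IsRationalPolyhedral σ) {w : DualLattice N} (hw : w ∈ dualMonoid σ)
    (hτ : ∀ x, x ∈ τ ↔ x ∈ σ ∧ realFunctional w x = 0) {u : DualLattice N}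
    (hu : u ∈ dualMonoid τ) : ∃ n : ℕ, u + n • w ∈ dualMonoid σ := by
  obtain ⟨S, rfl⟩ := hσ
  refine ⟨∑ s ∈ S, (u s).natAbs, mem_dualMonoid_hull.2 fun s hs => ?_⟩
  have hws : 0 ≤ w s := mem_dualMonoid_hull.1 hw s hs
  simp only [LinearMap.add_apply, LinearMap.smul_apply, nsmul_eq_mul]
  rcases hws.eq_or_lt with h0 | h0
  · have : toReal s ∈ τ := (hτ _).2 ⟨toReal_mem_hull hs, by rw [realFunctional_toReal, ← h0]; simp⟩
    have h1 := hu _ this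
    rw [realFunctional_toReal] at h1
    have h1 : 0 ≤ u s := by exact_mod_cast h1
    simp [← h0, h1]
  · have h1 : (u s).natAbs ≤ ∑ s ∈ S, (u s).natAbs :=
      Finset.single_le_sum (f := fun s => (u s).natAbs) (fun _ _ => Nat.zero_le _) hs
    have h2 : ((u s).natAbs : ℤ) ≤ ((∑ s ∈ S, (u s).natAbs : ℕ) : ℤ) := by exact_mod_cast h1
    have h3 : -((u s).natAbs : ℤ) ≤ u s := by omega
    nlinarith

/-- **Gordan's lemma**. -/
lemma dualMonoid_fg [Module.Finite ℤ N] [Module.Free ℤ N] {σ : PointedCone ℝ (RealSpan N)}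
    (hσ : IsRationalPolyhedral σ) : AddMonoid.FG (dualMonoid σ) := by
  obtain ⟨S, rfl⟩ := hσ
  have : AddGroup.FG (DualLattice N) := Module.Finite.iff_addGroup_fg.1 inferInstance
  have hM : AddMonoid.FG (DualLattice N) := inferInstance
  obtain ⟨n, h, hh⟩ := AddSubmonoid.fg_iff_exists_fin_addMonoidHom.1 hM.fg_top
  let ev : DualLattice N →+ (S → ℤ) :=
    { toFun := fun u s => u s, map_zero' := by ext; simp, map_add' := by intros; ext; simp }
  let f : (Fin n → ℕ) × (S → ℕ) →+ (S → ℤ) := ev.comp (h.comp (AddMonoidHom.fst _ _))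
  let g : (Fin n → ℕ) × (S → ℕ) →+ (S → ℤ) :=
    { toFun := fun p s => (p.2 s : ℤ), map_zero' := by ext; simp,
      map_add' := by intros; ext; simp }
  have hfg := AddSubmonoid.fg_eqLocusM f g
  have hmap := hfg.map (h.comp (AddMonoidHom.fst _ _))
  have heq : dualMonoid (PointedCone.hull ℝ (toReal '' (S : Set N))) =
      (f.eqLocusM g).map (h.comp (AddMonoidHom.fst _ _)) := by
    ext u
    rw [mem_dualMonoid_hull, AddSubmonoid.mem_map]
    constructor
    · intro hu
      obtain ⟨a, rfl⟩ : u ∈ AddMonoidHom.mrange h := by rw [hh]; trivial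
      refine ⟨(a, fun s => (h a s).toNat), ?_, rfl⟩
      change f _ = g _
      ext s
      simp only [f, g, ev, AddMonoidHom.coe_comp, Function.comp_apply, AddMonoidHom.coe_fst,
        AddMonoidHom.coe_mk, ZeroHom.coe_mk]
      exact (Int.toNat_of_nonneg (hu s s.2)).symm
    · rintro ⟨p, hp, rfl⟩ s hs
      have := congrFun (show f p = g p from hp) ⟨s, hs⟩
      simp only [f, g, ev, AddMonoidHom.coe_comp, Function.comp_apply, AddMonoidHom.coe_fst,
        AddMonoidHom.coe_mk, ZeroHom.coe_mk] at this
      simp only [AddMonoidHom.coe_comp, Function.comp_apply, AddMonoidHom.coe_fst]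
      omega
  rw [AddMonoid.fg_iff_addSubmonoid_fg, heq]
  exact hmap

end Cones


section Charts

variable {N : Type} [AddCommGroup N]

/-- The coordinate ring `k[σ^∨ ∩ M]` of the affine chart `U_σ`. -/
abbrev ChartRing (k : Type u) [Field k] (σ : PointedCone ℝ (RealSpan N)) : Type u :=
  AddMonoidAlgebra k (dualMonoid σ)

variable (k : Type u) [Field k]

/-- The inclusion `k[σ^∨ ∩ M] → k[τ^∨ ∩ M]` for `τ ⊆ σ`. -/
def chartMap {τ σ : PointedCone ℝ (RealSpan N)} (h : τ ≤ σ) : ChartRing k σ →ₐ[k] ChartRing k τ :=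
  AddMonoidAlgebra.mapDomainAlgHom k k (AddSubmonoid.inclusion (dualMonoid_anti h))

variable {k}

@[simp] lemma chartMap_single {τ σ : PointedCone ℝ (RealSpan N)} (h : τ ≤ σ) (u : dualMonoid σ)
    (c : k) : chartMap k h (AddMonoidAlgebra.single u c) =
      AddMonoidAlgebra.single (AddSubmonoid.inclusion (dualMonoid_anti h) u) c := by
  simp [chartMap]

lemma chartMap_injective {τ σ : PointedCone ℝ (RealSpan N)} (h : τ ≤ σ) :
    Function.Injective (chartMap k h) :=
  AddMonoidAlgebra.mapDomain_injective (AddSubmonoid.inclusion_injective _)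

instance [Module.Finite ℤ N] [Module.Free ℤ N] : UniqueSums (DualLattice N) := by
  have : AddGroup.FG (DualLattice N) := Module.Finite.iff_addGroup_fg.1 inferInstance
  have : IsAddTorsionFree (DualLattice N) :=
    Module.isTorsionFree_int_iff_isAddTorsionFree.1 inferInstance
  infer_instance

/-- The inclusion of `k[σ^∨ ∩ M]` in the group algebra `k[M]`. -/
def chartToGroupAlgebra (k : Type u) [Field k] (σ : PointedCone ℝ (RealSpan N)) :
    ChartRing k σ →ₐ[k] AddMonoidAlgebra k (DualLattice N) :=
  AddMonoidAlgebra.mapDomainAlgHom k k (dualMonoid σ).subtype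

lemma chartToGroupAlgebra_injective (σ : PointedCone ℝ (RealSpan N)) :
    Function.Injective (chartToGroupAlgebra k σ) :=
  AddMonoidAlgebra.mapDomain_injective Subtype.val_injective

instance [Module.Finite ℤ N] [Module.Free ℤ N] (σ : PointedCone ℝ (RealSpan N)) :
    IsDomain (ChartRing k σ) :=
  (chartToGroupAlgebra_injective σ).isDomain (chartToGroupAlgebra k σ).toRingHom

lemma chartRing_isNoetherian [Module.Finite ℤ N] [Module.Free ℤ N]
    {σ : PointedCone ℝ (RealSpan N)} (hσ : IsRationalPolyhedral σ) :
    IsNoetherianRing (ChartRing k σ) := by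
  have := dualMonoid_fg hσ
  exact Algebra.FiniteType.isNoetherianRing k _

/-- If `τ` is the face of `σ` cut out by `w`, then `k[τ^∨ ∩ M]` is the localization of
`k[σ^∨ ∩ M]` at the monomial `x^w`. -/
lemma chartMap_isLocalization {τ σ : PointedCone ℝ (RealSpan N)} (h : τ ≤ σ)
    (hσ : IsRationalPolyhedral σ) {w : DualLattice N} (hw : w ∈ dualMonoid σ)
    (hτ : ∀ x, x ∈ τ ↔ x ∈ σ ∧ realFunctional w x = 0) :
    letI := (chartMap k h).toRingHom.toAlgebra
    IsLocalization.Away (AddMonoidAlgebra.single (⟨w, hw⟩ : dualMonoid σ) (1 : k))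
      (ChartRing k τ) := by
  let := (chartMap k h).toRingHom.toAlgebra
  have hmap : ∀ f, algebraMap (ChartRing k σ) (ChartRing k τ) f = chartMap k h f := fun _ => rfl
  have hneg : -w ∈ dualMonoid τ := by
    intro x hx
    have := ((hτ x).1 hx).2
    simp only [realFunctional, map_neg, LinearMap.neg_apply] at this ⊢
    rw [this, neg_zero]
  refine (isLocalization_iff _ _).2 ⟨?_, ?_, ?_⟩
  · rintro ⟨_, n, rfl⟩
    simp only [map_pow]
    refine IsUnit.pow _ ?_
    refine .of_mul_eq_one (AddMonoidAlgebra.single (⟨-w, hneg⟩ : dualMonoid τ) (1 : k)) ?_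
    rw [hmap, chartMap_single, AddMonoidAlgebra.single_mul_single, AddMonoidAlgebra.one_def]
    congr 1
    · ext1; simp
    · simp
  · intro z
    suffices H : ∃ n : ℕ, ∃ f : ChartRing k σ, z * chartMap k h
        ((AddMonoidAlgebra.single (⟨w, hw⟩ : dualMonoid σ) (1 : k)) ^ n) = chartMap k h f by
      obtain ⟨n, f, hf⟩ := H
      exact ⟨(f, ⟨_, n, rfl⟩), hf⟩
    induction z using AddMonoidAlgebra.induction_linear with
    | zero => exact ⟨0, 0, by simp⟩
    | add f g hf hg =>
      obtain ⟨n, f', hf⟩ := hf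
      obtain ⟨m, g', hg⟩ := hg
      refine ⟨n + m, f' * (AddMonoidAlgebra.single (⟨w, hw⟩ : dualMonoid σ) (1 : k)) ^ m +
        g' * (AddMonoidAlgebra.single (⟨w, hw⟩ : dualMonoid σ) (1 : k)) ^ n, ?_⟩
      rw [map_add, map_mul, map_mul, ← hf, ← hg, pow_add, map_mul]
      ring
    | single u c =>
      obtain ⟨n, hn⟩ := exists_add_nsmul_mem hσ hw hτ u.2
      refine ⟨n, AddMonoidAlgebra.single ⟨_, hn⟩ c, ?_⟩
      rw [AddMonoidAlgebra.single_pow, chartMap_single, chartMap_single,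
        AddMonoidAlgebra.single_mul_single]
      congr 1
      simp
  · intro x y hxy
    exact ⟨1, by rw [chartMap_injective h hxy]⟩

/-- An integrally closed domain is integrally closed in each of its localizations. -/
lemma isIntegrallyClosedIn_of_isLocalization {R S : Type*} [CommRing R] [IsDomain R]
    [IsIntegrallyClosed R] [CommRing S] [IsDomain S] [Algebra R S] (P : Submonoid R)
    [IsLocalization P S] (hP : P ≤ nonZeroDivisors R) {x : S} (hx : IsIntegral R x) :
    ∃ y, algebraMap R S y = x := by
  let K := FractionRing R
  have hu : ∀ y : P, IsUnit (algebraMap R K y) := fun y =>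
    IsLocalization.map_units K (⟨y, hP y.2⟩ : nonZeroDivisors R)
  let g : S →+* K := IsLocalization.lift hu
  have hg : ∀ y, g (algebraMap R S y) = algebraMap R K y := IsLocalization.lift_eq hu
  have hinj : Function.Injective g := by
    refine (IsLocalization.lift_injective_iff hu).2 fun a b => ?_
    rw [(IsFractionRing.injective R K).eq_iff, (IsLocalization.injective S hP).eq_iff]
  have hgx : IsIntegral R (g x) := by
    obtain ⟨p, hp, hpx⟩ := hx
    refine ⟨p, hp, ?_⟩
    have : algebraMap R K = g.comp (algebraMap R S) := RingHom.ext fun y => (hg y).symm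
    rw [this, ← Polynomial.hom_eval₂, hpx, map_zero]
  obtain ⟨y, hy⟩ := IsIntegrallyClosed.algebraMap_eq_of_integral hgx
  exact ⟨y, hinj (by rw [hg, hy])⟩

lemma isIntegrallyClosed_groupAlgebra_fin (n : ℕ) :
    IsIntegrallyClosed (AddMonoidAlgebra k (Fin n → ℤ)) := by
  induction n with
  | zero => exact .of_equiv (AddMonoidAlgebra.uniqueRingEquiv (R := k) (Fin 0 → ℤ)).symm
  | succ n ih =>
    have h1 : IsIntegrallyClosed (LaurentPolynomial (AddMonoidAlgebra k (Fin n → ℤ))) :=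
      isIntegrallyClosed_of_isLocalization _
        (Submonoid.powers (Polynomial.X : Polynomial (AddMonoidAlgebra k (Fin n → ℤ))))
        (powers_le_nonZeroDivisors_of_noZeroDivisors Polynomial.X_ne_zero)
    exact .of_equiv ((AddMonoidAlgebra.curryRingEquiv (R := k) (M := ℤ) (N := Fin n → ℤ)).symm.trans
      (AddMonoidAlgebra.mapDomainRingEquiv k
        (Fin.consLinearEquiv ℤ (fun _ : Fin (n + 1) => ℤ)).toAddEquiv))

instance [Module.Finite ℤ N] [Module.Free ℤ N] :
    IsIntegrallyClosed (AddMonoidAlgebra k (DualLattice N)) := by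
  have := isIntegrallyClosed_groupAlgebra_fin (k := k) (Module.finrank ℤ (DualLattice N))
  exact .of_equiv (AddMonoidAlgebra.mapDomainRingEquiv k
    (Module.finBasis ℤ (DualLattice N)).equivFun.symm.toAddEquiv)

open scoped LaurentPolynomial in
/-- The ring homomorphism `x^u ↦ x^u T^⟨u, s⟩`. -/
def gradingHom (k : Type u) [Field k] (s : N) :
    AddMonoidAlgebra k (DualLattice N) →+* (AddMonoidAlgebra k (DualLattice N))[T;T⁻¹] :=
  (AddMonoidAlgebra.curryRingEquiv (R := k) (M := ℤ) (N := DualLattice N)).toRingHom.comp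
    (AddMonoidAlgebra.mapDomainRingHom k
      ({ toFun := fun u => (u s, u), map_zero' := by simp, map_add' := by simp } :
        DualLattice N →+ ℤ × DualLattice N))

lemma gradingHom_single (s : N) (u : DualLattice N) (c : k) :
    gradingHom k s (AddMonoidAlgebra.single u c) =
      AddMonoidAlgebra.single (u s) (AddMonoidAlgebra.single u c) := by
  simp [gradingHom]

lemma gradingHom_coeff (s : N) (f : AddMonoidAlgebra k (DualLattice N)) (u : DualLattice N) :
    ((gradingHom k s f).coeff (u s)).coeff u = f.coeff u := by
  classical
  induction f using AddMonoidAlgebra.induction_linear with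
  | zero => simp
  | add f g hf hg => simp [hf, hg]
  | single v c =>
    rw [gradingHom_single]
    by_cases h : v = u
    · subst h; rw [AddMonoidAlgebra.coeff_single]; simp
    · rw [AddMonoidAlgebra.coeff_single, AddMonoidAlgebra.coeff_single, Finsupp.single_apply]
      split_ifs <;> simp [h]

lemma chartRing_isIntegrallyClosed [Module.Finite ℤ N] [Module.Free ℤ N]
    {σ : PointedCone ℝ (RealSpan N)} (hσ : IsRationalPolyhedral σ) :
    IsIntegrallyClosed (ChartRing k σ) := by
  classical
  obtain ⟨S, rfl⟩ := hσ
  set σ := PointedCone.hull ℝ (toReal '' (S : Set N)) with hσ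
  let A := AddMonoidAlgebra k (DualLattice N)
  let : Algebra (ChartRing k σ) A := (chartToGroupAlgebra k σ).toRingHom.toAlgebra
  have hinj : Function.Injective (algebraMap (ChartRing k σ) A) := chartToGroupAlgebra_injective σ
  have : FaithfulSMul (ChartRing k σ) A := (faithfulSMul_iff_algebraMap_injective _ _).2 hinj
  suffices H : IsIntegrallyClosedIn (ChartRing k σ) A from
    .of_isIntegrallyClosed_of_isIntegrallyClosedIn _ A
  refine isIntegrallyClosedIn_iff.2 ⟨hinj, fun {f} hf => ?_⟩
  have hsupp : ∀ u ∈ f.coeff.support, u ∈ dualMonoid σ := by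
    intro u hu
    rw [hσ, mem_dualMonoid_hull]
    intro s hs
    by_contra hneg
    -- the image of `k[σ^∨ ∩ M]` lies in the polynomials
    have hpoly : ∀ g : ChartRing k σ, ∃ p : Polynomial A,
        algebraMap (Polynomial A) (LaurentPolynomial A) p =
          gradingHom k s (chartToGroupAlgebra k σ g) := by
      intro g
      induction g using AddMonoidAlgebra.induction_linear with
      | zero => exact ⟨0, by simp⟩
      | add g g' hg hg' =>
        obtain ⟨p, hp⟩ := hg
        obtain ⟨p', hp'⟩ := hg'
        exact ⟨p + p', by rw [map_add, map_add, map_add, hp, hp']⟩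
      | single v c =>
        have hv : 0 ≤ (v : DualLattice N) s := mem_dualMonoid_hull.1 v.2 s hs
        refine ⟨Polynomial.C (AddMonoidAlgebra.single (v : DualLattice N) c) *
          Polynomial.X ^ ((v : DualLattice N) s).toNat, ?_⟩
        have h1 : chartToGroupAlgebra k σ (AddMonoidAlgebra.single v c) =
            AddMonoidAlgebra.single (v : DualLattice N) c := by simp [chartToGroupAlgebra]
        rw [h1, gradingHom_single, LaurentPolynomial.algebraMap_eq_toLaurent,
          Polynomial.toLaurent_C_mul_X_pow, Int.toNat_of_nonneg hv,
          ← LaurentPolynomial.single_eq_C_mul_T]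
    have hint : IsIntegral (Polynomial A) (gradingHom k s f) := by
      obtain ⟨p, hp, hpf⟩ := hf
      have hinj' : Function.Injective (algebraMap (Polynomial A) (LaurentPolynomial A)) :=
        IsLocalization.injective (M := Submonoid.powers (Polynomial.X : Polynomial A)) _
          (powers_le_nonZeroDivisors_of_noZeroDivisors Polynomial.X_ne_zero)
      let R := (algebraMap (Polynomial A) (LaurentPolynomial A)).range
      let φ : ChartRing k σ →+* R :=
        ((gradingHom k s).comp (chartToGroupAlgebra k σ).toRingHom).codRestrict R
          (fun g => hpoly g)
      have h1 : IsIntegral R (gradingHom k s f) := by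
        refine ⟨p.map φ, hp.map φ, ?_⟩
        rw [Polynomial.eval₂_map]
        have : (algebraMap R (LaurentPolynomial A)).comp φ =
            (gradingHom k s).comp (algebraMap (ChartRing k σ) A) := rfl
        rw [this, ← Polynomial.hom_eval₂, hpf, map_zero]
      let e : Polynomial A ≃+* R := RingEquiv.ofBijective
        (algebraMap (Polynomial A) (LaurentPolynomial A)).rangeRestrict
        ⟨fun a b hab => hinj' (congrArg Subtype.val hab), RingHom.rangeRestrict_surjective _⟩
      obtain ⟨q, hq, hqf⟩ := h1
      refine ⟨q.map e.symm.toRingHom, hq.map _, ?_⟩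
      rw [Polynomial.eval₂_map]
      have : (algebraMap (Polynomial A) (LaurentPolynomial A)).comp e.symm.toRingHom =
          algebraMap R (LaurentPolynomial A) := by
        ext1 r
        exact congrArg Subtype.val (e.apply_symm_apply r)
      rw [this, hqf]
    obtain ⟨p, hp⟩ := isIntegrallyClosedIn_of_isLocalization
      (Submonoid.powers (Polynomial.X : Polynomial A))
      (powers_le_nonZeroDivisors_of_noZeroDivisors Polynomial.X_ne_zero) hint
    have hc := gradingHom_coeff s f u
    rw [← hp, LaurentPolynomial.algebraMap_eq_toLaurent] at hc
    have h0 : (Polynomial.toLaurent p).coeff (u s) = 0 := by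
      have : ∀ p : Polynomial A, (Polynomial.toLaurent p).coeff (u s) = 0 := by
        intro p
        induction p using Polynomial.induction_on' with
        | add p q hp hq => rw [map_add, AddMonoidAlgebra.coeff_add, Finsupp.add_apply, hp, hq, add_zero]
        | monomial n a =>
          rw [← Polynomial.C_mul_X_pow_eq_monomial, Polynomial.toLaurent_C_mul_X_pow,
            ← LaurentPolynomial.single_eq_C_mul_T, AddMonoidAlgebra.coeff_single,
            Finsupp.single_apply, if_neg (by omega)]
      exact this p
    rw [h0] at hc
    exact Finsupp.mem_support_iff.1 hu (by simpa using hc.symm)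
  refine ⟨∑ u ∈ f.coeff.support.attach,
    AddMonoidAlgebra.single (⟨u.1, hsupp u.1 u.2⟩ : dualMonoid σ) (f.coeff u.1), ?_⟩
  rw [map_sum]
  have h1 : ∀ u : f.coeff.support, algebraMap (ChartRing k σ) A
      (AddMonoidAlgebra.single (⟨u.1, hsupp u.1 u.2⟩ : dualMonoid σ) (f.coeff u.1)) =
      AddMonoidAlgebra.single u.1 (f.coeff u.1) := by
    intro u
    change chartToGroupAlgebra k σ _ = _
    simp [chartToGroupAlgebra]
  simp_rw [h1]
  rw [Finset.sum_attach _ (fun u => AddMonoidAlgebra.single u (f.coeff u))]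
  exact AddMonoidAlgebra.sum_coeff_single f

end Charts


section Scheme

variable {N : Type} [AddCommGroup N]

/-- The cones of a fan, partially ordered by inclusion (equivalently, by being a face). -/
abbrev Fan.Cone (Δ : Fan N) : Type := {σ : PointedCone ℝ (RealSpan N) // σ ∈ Δ.cones}

/-- The zero cone. -/
def Fan.zeroCone (Δ : Fan N) : Δ.Cone := ⟨⊥, Δ.bot_mem⟩

lemma Fan.isFace_of_le (Δ : Fan N) {τ σ : Δ.Cone} (h : τ ≤ σ) : IsFace τ.1 σ.1 := by
  have := (Δ.inter_face τ.1 τ.2 σ.1 σ.2).2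
  rwa [inf_eq_left.2 (show τ.1 ≤ σ.1 from h)] at this

lemma Fan.inf_mem (Δ : Fan N) (τ σ : Δ.Cone) : τ.1 ⊓ σ.1 ∈ Δ.cones :=
  Δ.face_mem _ τ.2 _ (Δ.inter_face τ.1 τ.2 σ.1 σ.2).1

lemma Fan.zeroCone_le (Δ : Fan N) (σ : Δ.Cone) : Δ.zeroCone ≤ σ :=
  show (⊥ : PointedCone ℝ (RealSpan N)) ≤ σ.1 from bot_le

variable (k : Type u) [Field k]

/-- The affine toric varieties `U_σ = Spec k[σ^∨ ∩ M]` of the cones of a fan, with the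
morphisms `U_τ ⟶ U_σ` for `τ ⊆ σ`. -/
def chartFunctor (Δ : Fan N) : Δ.Cone ⥤ Scheme.{u} where
  obj σ := Spec (.of (ChartRing k σ.1))
  map f := Spec.map (CommRingCat.ofHom (chartMap k (leOfHom f)).toRingHom)
  map_id σ := by
    rw [← Spec.map_id]
    congr 1
    ext1
    refine RingHom.ext fun x => ?_
    change chartMap k (le_refl σ.1) x = x
    induction x using AddMonoidAlgebra.induction_linear with
    | zero => simp
    | add f g hf hg => rw [map_add, hf, hg]
    | single u c => rw [chartMap_single]; rfl
  map_comp f g := by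
    rw [← Spec.map_comp]
    congr 1
    ext1
    refine RingHom.ext fun x => ?_
    change chartMap k (leOfHom (f ≫ g)) x = chartMap k (leOfHom f) (chartMap k (leOfHom g) x)
    induction x using AddMonoidAlgebra.induction_linear with
    | zero => simp
    | add f g hf hg => rw [map_add, hf, hg, map_add, map_add]
    | single u c => rw [chartMap_single, chartMap_single, chartMap_single]; rfl

variable [Module.Finite ℤ N]

lemma chartFunctor_map (Δ : Fan N) {τ σ : Δ.Cone} (f : τ ⟶ σ) :
    IsOpenImmersion ((chartFunctor k Δ).map f) ∧ ∃ (w : DualLattice N) (hw : w ∈ dualMonoid σ.1),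
      (∀ x, x ∈ τ.1 ↔ x ∈ σ.1 ∧ realFunctional w x = 0) ∧
      Set.range ((chartFunctor k Δ).map f) =
        (PrimeSpectrum.basicOpen (AddMonoidAlgebra.single (⟨w, hw⟩ : dualMonoid σ.1) (1 : k)) :
          Set (PrimeSpectrum (ChartRing k σ.1))) := by
  obtain ⟨w, hw, hτ⟩ := (Δ.isFace_of_le (leOfHom f)).exists_dual (Δ.rational _ σ.2)
  let := (chartMap k (show τ.1 ≤ σ.1 from leOfHom f)).toRingHom.toAlgebra
  have hloc := chartMap_isLocalization (k := k) (show τ.1 ≤ σ.1 from leOfHom f)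
    (Δ.rational _ σ.2) hw hτ
  refine ⟨?_, w, hw, hτ, ?_⟩
  · exact IsOpenImmersion.of_isLocalization
      (AddMonoidAlgebra.single (⟨w, hw⟩ : dualMonoid σ.1) (1 : k))
  · exact PrimeSpectrum.localization_away_comap_range (ChartRing k τ.1)
      (AddMonoidAlgebra.single (⟨w, hw⟩ : dualMonoid σ.1) (1 : k))

instance (Δ : Fan N) {τ σ : Δ.Cone} (f : τ ⟶ σ) :
    IsOpenImmersion ((chartFunctor k Δ).map f) := (chartFunctor_map k Δ f).1

instance (Δ : Fan N) : (chartFunctor k Δ ⋙ Scheme.forget).IsLocallyDirected where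
  cond {i j l} fi fj xi xj hij := by
    change (chartFunctor k Δ).map fi xi = (chartFunctor k Δ).map fj xj at hij
    let m : Δ.Cone := ⟨i.1 ⊓ j.1, Δ.inf_mem i j⟩
    let mi : m ⟶ i := homOfLE (show i.1 ⊓ j.1 ≤ i.1 from inf_le_left)
    let mj : m ⟶ j := homOfLE (show i.1 ⊓ j.1 ≤ j.1 from inf_le_right)
    obtain ⟨-, wi, hwi, hi, hri⟩ := chartFunctor_map k Δ fi
    obtain ⟨-, wj, hwj, hj, hrj⟩ := chartFunctor_map k Δ fj
    -- the point lies in the image of the chart of `i ⊓ j`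
    let x := (chartFunctor k Δ).map fi xi
    have hxi : x ∈ Set.range ((chartFunctor k Δ).map fi) := ⟨xi, rfl⟩
    have hxj : x ∈ Set.range ((chartFunctor k Δ).map fj) := ⟨xj, hij.symm⟩
    have hm : ∀ y, y ∈ m.1 ↔ y ∈ l.1 ∧ realFunctional (wi + wj) y = 0 := by
      intro y
      change y ∈ i.1 ∧ y ∈ j.1 ↔ _
      rw [hi, hj, realFunctional_add]
      constructor
      · rintro ⟨⟨h1, h2⟩, -, h3⟩; exact ⟨h1, by rw [h2, h3, add_zero]⟩
      · rintro ⟨h1, h2⟩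
        have h3 := hwi y h1
        have h4 := hwj y h1
        exact ⟨⟨h1, by linarith⟩, h1, by linarith⟩
    have hml : m.1 ≤ l.1 := fun y hy => ((hm y).1 hy).1
    have hxm : x ∈ Set.range ((chartFunctor k Δ).map (mi ≫ fi)) := by
      let := (chartMap k hml).toRingHom.toAlgebra
      have hloc := chartMap_isLocalization (k := k) hml (Δ.rational _ l.2)
        (add_mem hwi hwj) hm
      have hr : Set.range ((chartFunctor k Δ).map (mi ≫ fi)) =
          (PrimeSpectrum.basicOpen (AddMonoidAlgebra.single
            (⟨wi + wj, add_mem hwi hwj⟩ : dualMonoid l.1) (1 : k)) :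
          Set (PrimeSpectrum (ChartRing k l.1))) :=
        PrimeSpectrum.localization_away_comap_range (ChartRing k m.1) _
      have hs : (AddMonoidAlgebra.single (⟨wi + wj, add_mem hwi hwj⟩ : dualMonoid l.1) (1 : k)) =
          AddMonoidAlgebra.single (⟨wi, hwi⟩ : dualMonoid l.1) (1 : k) *
            AddMonoidAlgebra.single (⟨wj, hwj⟩ : dualMonoid l.1) (1 : k) := by
        rw [AddMonoidAlgebra.single_mul_single, one_mul]; rfl
      rw [hr, hs, PrimeSpectrum.basicOpen_mul]
      rw [hri] at hxi
      rw [hrj] at hxj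
      exact ⟨hxi, hxj⟩
    obtain ⟨y, hy⟩ := hxm
    refine ⟨m, mi, mj, y, ?_, ?_⟩
    · apply ((chartFunctor k Δ).map fi).isOpenEmbedding.injective
      change (chartFunctor k Δ).map fi ((chartFunctor k Δ).map mi y) = _
      rw [← Scheme.Hom.comp_apply, ← Functor.map_comp, hy]
    · apply ((chartFunctor k Δ).map fj).isOpenEmbedding.injective
      change (chartFunctor k Δ).map fj ((chartFunctor k Δ).map mj y) = _
      rw [← Scheme.Hom.comp_apply, ← Functor.map_comp, ← hij,
        show mj ≫ fj = mi ≫ fi from Subsingleton.elim _ _, hy]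

/-- The toric variety `X(Δ)`, glued from the affine charts `U_σ`, `σ ∈ Δ`, along the open
subschemes `U_{σ ∩ τ}`. -/
def toricVariety (Δ : Fan N) : Scheme.{u} := colimit (chartFunctor k Δ)

/-- The open immersion `U_σ ⟶ X(Δ)`. -/
def chartι {Δ : Fan N} (σ : Δ.Cone) : Spec (.of (ChartRing k σ.1)) ⟶ toricVariety k Δ :=
  colimit.ι (chartFunctor k Δ) σ

instance {Δ : Fan N} (σ : Δ.Cone) : IsOpenImmersion (chartι k σ) :=
  inferInstanceAs (IsOpenImmersion (colimit.ι (chartFunctor k Δ) σ))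

/-- The cover of `X(Δ)` by the charts `U_σ`. -/
def chartCover (Δ : Fan N) : (toricVariety k Δ).OpenCover :=
  Scheme.IsLocallyDirected.openCover (chartFunctor k Δ)

lemma exists_chartι_eq {Δ : Fan N} (x : toricVariety k Δ) :
    ∃ (σ : Δ.Cone) (y : Spec (.of (ChartRing k σ.1))), chartι k σ y = x :=
  Scheme.IsLocallyDirected.ι_jointly_surjective (chartFunctor k Δ) x

lemma chartFunctor_map_chartι {Δ : Fan N} {τ σ : Δ.Cone} (f : τ ⟶ σ) :
    (chartFunctor k Δ).map f ≫ chartι k σ = chartι k τ :=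
  colimit.w (chartFunctor k Δ) f

variable [Module.Free ℤ N]

instance (Δ : Fan N) : IsLocallyNoetherian (toricVariety k Δ) := by
  rw [isLocallyNoetherian_iff_openCover (chartCover k Δ)]
  intro σ
  have := chartRing_isNoetherian (k := k) (Δ.rational _ σ.2)
  exact inferInstanceAs (IsLocallyNoetherian (Spec (.of (ChartRing k σ.1))))

instance (Δ : Fan N) : IrreducibleSpace (toricVariety k Δ) := by
  have h0 : IsIrreducible (Set.range (chartι k Δ.zeroCone)) := by
    rw [← Set.image_univ]
    exact (IrreducibleSpace.isIrreducible_univ _).image _ (chartι k _).continuous.continuousOn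
  have hcl : closure (Set.range (chartι k Δ.zeroCone)) = Set.univ := by
    refine Set.eq_univ_of_forall fun x => ?_
    obtain ⟨σ, y, rfl⟩ := exists_chartι_eq k x
    let f : Δ.zeroCone ⟶ σ := homOfLE (Δ.zeroCone_le σ)
    let g : Spec (.of (ChartRing k Δ.zeroCone.1)) ⟶ Spec (.of (ChartRing k σ.1)) :=
      (chartFunctor k Δ).map f
    have hg : IsOpenImmersion g := (chartFunctor_map k Δ f).1
    have hd : Dense (Set.range g) :=
      g.isOpenEmbedding.isOpen_range.dense (Set.range_nonempty _)
    have hy : chartι k σ y ∈ chartι k σ '' closure (Set.range g) := ⟨y, hd y, rfl⟩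
    refine closure_mono ?_ (image_closure_subset_closure_image (chartι k σ).continuous hy)
    rintro _ ⟨_, ⟨z, rfl⟩, rfl⟩
    exact ⟨z, by rw [← Scheme.Hom.comp_apply, ← chartFunctor_map_chartι k f]; rfl⟩
  have := h0.closure
  rw [hcl] at this
  exact (irreducibleSpace_def _).2 this

instance (Δ : Fan N) : AlgebraicGeometry.IsReduced (toricVariety k Δ) := by
  have : ∀ σ : (chartCover k Δ).I₀, AlgebraicGeometry.IsReduced ((chartCover k Δ).X σ) := fun σ =>
    inferInstanceAs (AlgebraicGeometry.IsReduced (Spec (.of (ChartRing k (σ : Δ.Cone).1))))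
  exact AlgebraicGeometry.IsReduced.of_openCover _ (chartCover k Δ)

instance (Δ : Fan N) : AlgebraicGeometry.IsIntegral (toricVariety k Δ) :=
  isIntegral_of_irreducibleSpace_of_isReduced _

lemma isIntegrallyClosed_stalk_structureSheaf (R : Type u) [CommRing R] [IsDomain R]
    [IsIntegrallyClosed R] (y : PrimeSpectrum R) :
    IsIntegrallyClosed ((Spec.structureSheaf R).presheaf.stalk y) :=
  isIntegrallyClosed_of_isLocalization _ y.asIdeal.primeCompl
    (Ideal.primeCompl_le_nonZeroDivisors _)

/-- The toric variety `X(Δ)` is normal. -/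
instance (Δ : Fan N) (x : toricVariety k Δ) :
    IsIntegrallyClosed ((toricVariety k Δ).presheaf.stalk x) := by
  obtain ⟨σ, y, rfl⟩ := exists_chartι_eq k x
  have h1 := chartRing_isIntegrallyClosed (k := k) (Δ.rational _ σ.2)
  have h2 : IsIntegrallyClosed ((Spec (.of (ChartRing k σ.1))).presheaf.stalk y) :=
    isIntegrallyClosed_stalk_structureSheaf (ChartRing k σ.1) y
  exact .of_equiv (asIso ((chartι k σ).stalkMap y)).symm.commRingCatIsoToRingEquiv

end Scheme


section WeilDivisors

variable (X : Scheme.{u})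

/-- A prime divisor of `X`, given by its generic point, a point of codimension one. -/
abbrev PrimeDivisor : Type u := {z : X // Order.coheight z = 1}

/-- The group of Weil divisors. -/
abbrev WeilDivisor : Type u := PrimeDivisor X →₀ ℤ

variable [AlgebraicGeometry.IsIntegral X] [IsLocallyNoetherian X]

/-- The subgroup of principal divisors `div(f)`, for `f` a nonzero rational function. -/
def principalDivisors : AddSubgroup (WeilDivisor X) where
  carrier := {D | ∃ f : X.functionField, f ≠ 0 ∧ ∀ z : PrimeDivisor X, D z = X.ord f z.1}
  zero_mem' := ⟨1, one_ne_zero, fun z => by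
    have := Scheme.ord_mul (X := X) (x := z.1) (one_ne_zero (α := X.functionField)) one_ne_zero
    rw [mul_one] at this
    simp only [Finsupp.coe_zero, Pi.zero_apply]
    omega⟩
  add_mem' := by
    rintro D E ⟨f, hf, hD⟩ ⟨g, hg, hE⟩
    exact ⟨f * g, mul_ne_zero hf hg, fun z => by
      rw [Finsupp.add_apply, hD, hE, Scheme.ord_mul hf hg]⟩
  neg_mem' := by
    rintro D ⟨f, hf, hD⟩
    refine ⟨f⁻¹, inv_ne_zero hf, fun z => ?_⟩
    have h1 := Scheme.ord_mul (X := X) (x := z.1) (one_ne_zero (α := X.functionField)) one_ne_zero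
    have h2 := Scheme.ord_mul (X := X) (x := z.1) hf (inv_ne_zero hf)
    rw [mul_one] at h1
    rw [mul_inv_cancel₀ hf] at h2
    rw [Finsupp.neg_apply, hD]
    omega

/-- The divisor class group `Cl(X)`: Weil divisors modulo principal divisors. -/
abbrev DivisorClassGroup : Type u := WeilDivisor X ⧸ principalDivisors X

variable {X}

lemma isDiscreteValuationRing_stalk (z : PrimeDivisor X)
    [IsIntegrallyClosed (X.presheaf.stalk z.1)] :
    IsDiscreteValuationRing (X.presheaf.stalk z.1) := by
  have hdim : Ring.KrullDimLE 1 (X.presheaf.stalk z.1) := krullDimLE_of_coheight_le z.2.le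
  have hnf : ¬ IsField (X.presheaf.stalk z.1) := by
    intro h
    have h1 := ringKrullDim_stalk_eq_coheight z.1
    rw [ringKrullDim_eq_zero_of_isField h, z.2] at h1
    exact absurd h1 (by decide)
  have h1 : Ring.DimensionLEOne (X.presheaf.stalk z.1) :=
    ⟨fun hp hP => (Ring.krullDimLE_one_iff_of_noZeroDivisors.1 hdim) _ hp hP⟩
  have h2 : IsDedekindDomain (X.presheaf.stalk z.1) := {}
  exact ((IsDiscreteValuationRing.TFAE _ hnf).out 2 0).1 h2

/-- The sections of the sheaf `𝒪(D)` over a nonempty open `U`: the rational functions `f` with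
`f = 0` or `div(f) + D ≥ 0` on `U`. -/
def sectionsOn [∀ x : X, IsIntegrallyClosed (X.presheaf.stalk x)] (D : WeilDivisor X)
    (U : X.Opens) : AddSubgroup X.functionField where
  carrier := {f | f = 0 ∨ ∀ z : PrimeDivisor X, z.1 ∈ U → 0 ≤ X.ord f z.1 + D z}
  zero_mem' := Or.inl rfl
  add_mem' := by
    rintro f g (rfl | hf) (rfl | hg)
    · left; simp
    · right; simpa using hg
    · right; simpa using hf
    · by_cases h : f + g = 0
      · exact Or.inl h
      · refine Or.inr fun z hz => ?_
        have := isDiscreteValuationRing_stalk z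
        have h1 := Scheme.ord_add (x := z.1) h
        have h2 := hf z hz
        have h3 := hg z hz
        rcases min_le_iff.1 h1 with h4 | h4 <;> omega
  neg_mem' := by
    rintro f (rfl | hf)
    · left; simp
    · by_cases h0 : f = 0
      · left; simp [h0]
      refine Or.inr fun z hz => ?_
      have h1 := Scheme.ord_mul (X := X) (x := z.1) (one_ne_zero (α := X.functionField)) one_ne_zero
      have hn : (-1 : X.functionField) ≠ 0 := neg_ne_zero.2 one_ne_zero
      have h2 := Scheme.ord_mul (X := X) (x := z.1) hn hn
      have h3 := Scheme.ord_mul (X := X) (x := z.1) hn h0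
      rw [mul_one] at h1
      rw [neg_mul_neg, mul_one] at h2
      rw [neg_one_mul] at h3
      have h4 := hf z hz
      omega

end WeilDivisors

section Toric

variable (k : Type u) [Field k] {N : Type} [AddCommGroup N]

lemma mem_dualMonoid_bot (u : DualLattice N) :
    u ∈ dualMonoid (⊥ : PointedCone ℝ (RealSpan N)) := by
  intro x hx
  rw [(Submodule.mem_bot _).1 hx, map_zero]

/-- The points `t ∈ T(k) = Hom(M, k^*)` of the torus. -/
abbrev TorusPoint (k : Type u) [Field k] (N : Type) [AddCommGroup N] : Type u :=
  Multiplicative (DualLattice N) →* kˣ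

variable {k} in
/-- The action of `t ∈ T(k)` on `k[σ^∨ ∩ M]`, `x^u ↦ t(u) x^u`. -/
def chartAction (t : TorusPoint k N) (σ : PointedCone ℝ (RealSpan N)) :
    ChartRing k σ →ₐ[k] ChartRing k σ :=
  AddMonoidAlgebra.lift k (ChartRing k σ) (dualMonoid σ)
    { toFun := fun u => AddMonoidAlgebra.single u.toAdd
        (t (Multiplicative.ofAdd (u.toAdd : DualLattice N)) : k)
      map_one' := by
        rw [AddMonoidAlgebra.one_def]
        simp
      map_mul' := fun a b => by
        rw [AddMonoidAlgebra.single_mul_single]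
        simp }

variable {k} in
lemma chartAction_single (t : TorusPoint k N) (σ : PointedCone ℝ (RealSpan N))
    (u : dualMonoid σ) (c : k) :
    chartAction t σ (AddMonoidAlgebra.single u c) =
      AddMonoidAlgebra.single u (c * t (Multiplicative.ofAdd (u : DualLattice N))) := by
  simp [chartAction]

variable [Module.Finite ℤ N]

/-- The structure morphism `X(Δ) ⟶ Spec k`. -/
def structureMorphism (Δ : Fan N) : toricVariety k Δ ⟶ Spec (.of k) :=
  colimit.desc (chartFunctor k Δ)
    { pt := Spec (.of k)
      ι :=
        { app := fun σ => Spec.map (CommRingCat.ofHom (algebraMap k (ChartRing k σ.1)))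
          naturality := fun τ σ f => by
            change Spec.map (CommRingCat.ofHom (chartMap k (leOfHom f)).toRingHom) ≫ _ = _ ≫ 𝟙 _
            rw [Category.comp_id, ← Spec.map_comp, ← CommRingCat.ofHom_comp]
            congr 2
            exact (chartMap k (leOfHom f)).comp_algebraMap } }

/-- The constants `k → Γ(X(Δ), 𝒪)`. -/
def constants (Δ : Fan N) : k →+* Γ(toricVariety k Δ, ⊤) :=
  ((Scheme.ΓSpecIso (.of k)).inv ≫ (structureMorphism k Δ).appTop).hom

variable {k}

/-- The action of `t ∈ T(k)` on `X(Δ)`. -/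
def torusAction {Δ : Fan N} (t : TorusPoint k N) : toricVariety k Δ ⟶ toricVariety k Δ :=
  colimMap
    { app := fun σ => Spec.map (CommRingCat.ofHom (chartAction t σ.1).toRingHom)
      naturality := fun τ σ f => by
        change Spec.map (CommRingCat.ofHom (chartMap k (leOfHom f)).toRingHom) ≫ _ =
          _ ≫ Spec.map (CommRingCat.ofHom (chartMap k (leOfHom f)).toRingHom)
        rw [← Spec.map_comp, ← Spec.map_comp, ← CommRingCat.ofHom_comp, ← CommRingCat.ofHom_comp]
        congr 2
        refine RingHom.ext fun x => ?_
        change chartMap k (leOfHom f) (chartAction t _ x) =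
          chartAction t _ (chartMap k (leOfHom f) x)
        induction x using AddMonoidAlgebra.induction_linear with
        | zero => simp
        | add f g hf hg => simp only [map_add, hf, hg]
        | single u c => simp only [chartAction_single, chartMap_single]; rfl }

/-- A Weil divisor on `X(Δ)` is torus-invariant if its coefficients are constant along the orbits of
the torus on the set of prime divisors. -/
def IsTorusInvariant {Δ : Fan N} (D : WeilDivisor (toricVariety k Δ)) : Prop :=
  ∀ (t : TorusPoint k N) (Y Z : PrimeDivisor (toricVariety k Δ)),
    torusAction t Y.1 = Z.1 → D Z = D Y

variable [Module.Free ℤ N]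

instance (Δ : Fan N) : Nonempty (⊤ : (toricVariety k Δ).Opens) :=
  ⟨⟨genericPoint _, trivial⟩⟩

/-- The function field `k(X)` is an extension of `k`. -/
instance (Δ : Fan N) : Algebra k (toricVariety k Δ).functionField :=
  (((toricVariety k Δ).germToFunctionField ⊤).hom.comp (constants k Δ)).toAlgebra

/-- The space `H⁰(X(Δ), 𝒪(D))` of global sections of the sheaf `𝒪(D)`. -/
def globalSections {Δ : Fan N} (D : WeilDivisor (toricVariety k Δ)) :
    Submodule k (toricVariety k Δ).functionField where
  __ := (sectionsOn D ⊤).toAddSubmonoid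
  smul_mem' := by
    rintro c f (rfl | hf)
    · exact Or.inl (smul_zero c)
    · by_cases h : c = 0 ∨ f = 0
      · left
        rcases h with h | h <;> simp [h]
      push Not at h
      refine Or.inr fun z hz => ?_
      have hu : IsUnit (constants k Δ c) := (IsUnit.mk0 c h.1).map _
      have h1 : c • f = (toricVariety k Δ).germToFunctionField ⊤ (constants k Δ c) * f := by
        rw [Algebra.smul_def]; rfl
      have h2 : (toricVariety k Δ).germToFunctionField ⊤ (constants k Δ c) ≠ 0 :=
        (hu.map ((toricVariety k Δ).germToFunctionField ⊤).hom).ne_zero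
      rw [h1, Scheme.ord_mul h2 h.2, Scheme.ord_of_isUnit hu (x := z.1) trivial, zero_add]
      exact hf z hz

lemma mem_globalSections {Δ : Fan N} {D : WeilDivisor (toricVariety k Δ)}
    {f : (toricVariety k Δ).functionField} :
    f ∈ globalSections D ↔ f = 0 ∨ ∀ z, 0 ≤ (toricVariety k Δ).ord f z.1 + D z := by
  change (f = 0 ∨ ∀ z : PrimeDivisor (toricVariety k Δ),
    z.1 ∈ (⊤ : (toricVariety k Δ).Opens) → _) ↔ _
  simp

variable (k) in
/-- The inclusion `k[M] → k(X)` of the coordinate ring of the torus `U_0` in the function field. -/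
def torusToFunctionField (Δ : Fan N) :
    ChartRing k Δ.zeroCone.1 →+* (toricVariety k Δ).functionField :=
  haveI : Nonempty (chartι k Δ.zeroCone ''ᵁ ⊤) :=
    ⟨⟨chartι k Δ.zeroCone (genericPoint _), ⟨_, trivial, rfl⟩⟩⟩
  ((Scheme.ΓSpecIso (.of (ChartRing k Δ.zeroCone.1))).inv ≫
    ((chartι k Δ.zeroCone).appIso ⊤).inv ≫
    (toricVariety k Δ).germToFunctionField (chartι k Δ.zeroCone ''ᵁ ⊤)).hom

variable (k) in
/-- The character `x^u`, `u ∈ M`, as a rational function on `X(Δ)`. -/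
def character (Δ : Fan N) (u : DualLattice N) : (toricVariety k Δ).functionField :=
  torusToFunctionField k Δ (AddMonoidAlgebra.single ⟨u, mem_dualMonoid_bot u⟩ 1)

end Toric

section Rays

variable {N : Type} [AddCommGroup N]

/-- A lattice vector is primitive if it is not a proper multiple of a lattice vector. -/
def IsPrimitive (v : N) : Prop := ∀ (n : ℤ) (w : N), v = n • w → IsUnit n

/-- The ray `ℝ_{≥0} v`. -/
def rayCone (v : N) : PointedCone ℝ (RealSpan N) := PointedCone.hull ℝ (toReal '' {v})

/-- The set `Δ(1)` of rays of the fan. A ray is represented by its primitive generator. -/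
@[ext] structure Fan.Ray (Δ : Fan N) where
  gen : N
  isPrimitive : IsPrimitive gen
  mem : rayCone gen ∈ Δ.cones

/-- The ray as a cone of the fan. -/
def Fan.Ray.cone {Δ : Fan N} (ρ : Δ.Ray) : Δ.Cone := ⟨rayCone ρ.gen, ρ.mem⟩

lemma IsPrimitive.exists_eq_one [Module.Finite ℤ N] [Module.Free ℤ N] {v : N}
    (hv : IsPrimitive v) : ∃ m : DualLattice N, m v = 1 := by
  let b := Module.finBasis ℤ N
  let ev : DualLattice N →ₗ[ℤ] ℤ := LinearMap.applyₗ v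
  obtain ⟨d, hd⟩ := (IsPrincipalIdealRing.principal (LinearMap.range ev : Ideal ℤ)).principal
  have hdvd : ∀ m : DualLattice N, d ∣ m v := by
    intro m
    have : m v ∈ (LinearMap.range ev : Ideal ℤ) := ⟨m, rfl⟩
    rw [hd] at this
    exact Ideal.mem_span_singleton.1 this
  choose c hc using fun i => hdvd (b.coord i)
  have hunit : IsUnit d := by
    refine hv d (∑ i, c i • b i) ?_
    rw [Finset.smul_sum, ← b.sum_repr v]
    refine Finset.sum_congr rfl fun i _ => ?_
    have := hc i
    simp only [Module.Basis.coord_apply] at this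
    rw [this, smul_smul]
  have h1 : (1 : ℤ) ∈ (LinearMap.range ev : Ideal ℤ) := by
    rw [hd]
    exact Ideal.mem_span_singleton.2 hunit.dvd
  exact h1

lemma mem_dualMonoid_rayCone {v : N} {u : DualLattice N} :
    u ∈ dualMonoid (rayCone v) ↔ 0 ≤ u v := by
  rw [rayCone, mem_dualMonoid_hull]; simp

lemma rayCone_injOn [Module.Finite ℤ N] [Module.Free ℤ N] {v w : N} (hv : IsPrimitive v)
    (hw : IsPrimitive w) (h : rayCone v = rayCone w) : v = w := by
  -- a functional is nonnegative on `v` iff it is on `w`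
  have key : ∀ u : DualLattice N, 0 ≤ u v ↔ 0 ≤ u w := fun u => by
    rw [← mem_dualMonoid_rayCone, h, mem_dualMonoid_rayCone]
  have key0 : ∀ u : DualLattice N, u v = 0 → u w = 0 := fun u hu => by
    have h1 := (key u).1 hu.ge
    have h2 := (key (-u)).1 (by simp [hu])
    simp only [LinearMap.neg_apply] at h2
    omega
  obtain ⟨m, hm⟩ := hv.exists_eq_one
  have hall : ∀ u : DualLattice N, u w = u v * m w := fun u => by
    have := key0 (u - u v • m) (by simp [hm])
    simp only [LinearMap.sub_apply, LinearMap.smul_apply, smul_eq_mul] at this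
    omega
  obtain ⟨m', hm'⟩ := hw.exists_eq_one
  have h1 := hall m'
  rw [hm'] at h1
  have h2 : 0 ≤ m w := (key m).1 (by omega)
  have h3 : m w = 1 := Int.eq_one_of_mul_eq_one_left h2 h1.symm
  refine (Module.finBasis ℤ N).ext_elem fun i => ?_
  have := hall ((Module.finBasis ℤ N).coord i)
  rw [h3, mul_one] at this
  exact this.symm

instance [Module.Finite ℤ N] [Module.Free ℤ N] (Δ : Fan N) : Finite Δ.Ray := by
  have := Δ.finite.to_subtype
  refine Finite.of_injective (fun ρ : Δ.Ray => ρ.cone) fun ρ ρ' h => ?_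
  exact Fan.Ray.ext (rayCone_injOn ρ.isPrimitive ρ'.isPrimitive (congrArg Subtype.val h))

instance [Module.Finite ℤ N] [Module.Free ℤ N] (Δ : Fan N) : Fintype Δ.Ray := Fintype.ofFinite _

variable (k : Type u) [Field k]

/-- The ideal of `Y(v)` in the chart `U_ρ` of the ray `ρ = ℝ_{≥0} v`: it is generated by the `x^u`
with `⟨u, v⟩ > 0`. -/
def rayIdeal (v : N) : Ideal (ChartRing k (rayCone v)) :=
  Ideal.span {f | ∃ u : dualMonoid (rayCone v), 0 < (u : DualLattice N) v ∧
    f = AddMonoidAlgebra.single u 1}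

variable {k}

lemma rayIdeal_eq_span {v : N} {m : dualMonoid (rayCone v)} (hm : (m : DualLattice N) v = 1) :
    rayIdeal k v = Ideal.span {AddMonoidAlgebra.single m 1} := by
  apply le_antisymm
  · refine Ideal.span_le.2 ?_
    rintro _ ⟨u, hu, rfl⟩
    refine Ideal.mem_span_singleton'.2 ⟨AddMonoidAlgebra.single
      (⟨u - m, mem_dualMonoid_rayCone.2 (by rw [LinearMap.sub_apply, hm]; omega)⟩ :
        dualMonoid (rayCone v)) 1, ?_⟩
    rw [AddMonoidAlgebra.single_mul_single, one_mul]
    congr 1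
    ext1
    simp
  · refine Ideal.span_mono ?_
    rintro _ rfl
    exact ⟨m, by omega, rfl⟩

lemma mem_rayIdeal_iff {v : N} {f : ChartRing k (rayCone v)} :
    f ∈ rayIdeal k v ↔ ∀ u : dualMonoid (rayCone v), (u : DualLattice N) v = 0 → f.coeff u = 0 := by
  classical
  constructor
  · intro hf
    refine Submodule.span_induction ?_ ?_ ?_ ?_ hf
    · rintro _ ⟨w, hw, rfl⟩ u hu
      rw [AddMonoidAlgebra.coeff_single, Finsupp.single_apply, if_neg]
      rintro rfl
      omega
    · intro u _; simp
    · intro a b _ _ ha hb u hu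
      simp [ha u hu, hb u hu]
    · intro a b _ hb u hu
      rw [smul_eq_mul]
      induction a using AddMonoidAlgebra.induction_linear with
      | zero => simp
      | add a a' h h' => rw [add_mul, AddMonoidAlgebra.coeff_add, Finsupp.add_apply, h, h', add_zero]
      | single w c =>
        rw [AddMonoidAlgebra.coeff_mul, AddMonoidAlgebra.coeff_single, Finsupp.sum_single_index (by simp)]
        refine Finset.sum_eq_zero fun w' _ => ?_
        dsimp only
        split_ifs with h
        · have h1 : 0 ≤ (w : DualLattice N) v := mem_dualMonoid_rayCone.1 w.2
          have h2 : 0 ≤ (w' : DualLattice N) v := mem_dualMonoid_rayCone.1 w'.2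
          have h3 : (w : DualLattice N) v + (w' : DualLattice N) v = 0 := by
            rw [← hu, ← h]; simp
          rw [hb w' (by omega), mul_zero]
        · rfl
  · intro hf
    rw [← AddMonoidAlgebra.sum_coeff_single f]
    refine Ideal.sum_mem _ fun u hu => ?_
    have h1 : 0 ≤ (u : DualLattice N) v := mem_dualMonoid_rayCone.1 u.2
    have h2 : (u : DualLattice N) v ≠ 0 := fun h => Finsupp.mem_support_iff.1 hu (hf u h)
    have h3 : AddMonoidAlgebra.single u (f.coeff u) =
        AddMonoidAlgebra.single 0 (f.coeff u) * AddMonoidAlgebra.single u (1 : k) := by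
      rw [AddMonoidAlgebra.single_mul_single, zero_add, mul_one]
    change AddMonoidAlgebra.single u (f.coeff u) ∈ _
    rw [h3]
    exact Ideal.mul_mem_left _ _ (Ideal.subset_span ⟨u, by omega, rfl⟩)

/-- The restriction `k[ρ^∨ ∩ M] → k[M]`, `x^u ↦ x^u` if `⟨u, v⟩ = 0` and `x^u ↦ 0` otherwise. -/
def rayRestriction (k : Type u) [Field k] (v : N) :
    ChartRing k (rayCone v) →ₐ[k] AddMonoidAlgebra k (DualLattice N) :=
  open scoped Classical in
  AddMonoidAlgebra.lift k _ (dualMonoid (rayCone v))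
    { toFun := fun u => if (u.toAdd : DualLattice N) v = 0 then
        AddMonoidAlgebra.single (u.toAdd : DualLattice N) 1 else 0
      map_one' := by simp [AddMonoidAlgebra.one_def]
      map_mul' := fun a b => by
        have h1 : 0 ≤ (a.toAdd : DualLattice N) v := mem_dualMonoid_rayCone.1 a.toAdd.2
        have h2 : 0 ≤ (b.toAdd : DualLattice N) v := mem_dualMonoid_rayCone.1 b.toAdd.2
        simp only [toAdd_mul, AddSubmonoid.coe_add, LinearMap.add_apply]
        by_cases ha : (a.toAdd : DualLattice N) v = 0
        · by_cases hb : (b.toAdd : DualLattice N) v = 0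
          · simp [ha, hb, AddMonoidAlgebra.single_mul_single]
          · simp [ha, hb]
        · rw [if_neg (by omega), if_neg ha, zero_mul] }

lemma rayRestriction_coeff (v : N) (f : ChartRing k (rayCone v)) (u : dualMonoid (rayCone v)) :
    (rayRestriction k v f).coeff (u : DualLattice N) =
      open scoped Classical in if (u : DualLattice N) v = 0 then f.coeff u else 0 := by
  classical
  induction f using AddMonoidAlgebra.induction_linear with
  | zero => simp
  | add f g hf hg =>
    rw [map_add, AddMonoidAlgebra.coeff_add, AddMonoidAlgebra.coeff_add, Finsupp.add_apply, hf, hg,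
      Finsupp.add_apply]
    split_ifs <;> simp
  | single w c =>
    rw [rayRestriction, AddMonoidAlgebra.lift_single]
    simp only [MonoidHom.coe_mk, OneHom.coe_mk, toAdd_ofAdd, smul_ite, smul_zero,
      AddMonoidAlgebra.smul_single, smul_eq_mul, mul_one]
    by_cases h : w = u
    · subst h; split_ifs <;> simp
    · have h' : (w : DualLattice N) ≠ u := fun h' => h (Subtype.ext h')
      split_ifs <;> simp [h, h']

variable [Module.Finite ℤ N] [Module.Free ℤ N]

lemma rayIdeal_isPrime (v : N) : (rayIdeal k v).IsPrime := by
  classical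
  have : rayIdeal k v = RingHom.ker (rayRestriction k v).toRingHom := by
    ext f
    rw [mem_rayIdeal_iff, RingHom.mem_ker]
    change _ ↔ rayRestriction k v f = 0
    constructor
    · intro hf
      have : f ∈ rayIdeal k v := mem_rayIdeal_iff.2 hf
      refine Submodule.span_induction ?_ ?_ ?_ ?_ this
      · rintro _ ⟨w, hw, rfl⟩
        rw [rayRestriction, AddMonoidAlgebra.lift_single]
        simp [hw.ne']
      · simp
      · intro a b _ _ ha hb; rw [map_add, ha, hb, add_zero]
      · intro a b _ hb; rw [smul_eq_mul, map_mul, hb, mul_zero]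
    · intro hf u hu
      have := rayRestriction_coeff v f u
      rw [hf, if_pos hu] at this
      simpa using this.symm
  rw [this]
  exact RingHom.ker_isPrime _

lemma rayIdeal_height {v : N} (hv : IsPrimitive v) : (rayIdeal k v).height = 1 := by
  obtain ⟨m, hm⟩ := hv.exists_eq_one
  let m' : dualMonoid (rayCone v) := ⟨m, mem_dualMonoid_rayCone.2 (by omega)⟩
  have : IsNoetherianRing (ChartRing k (rayCone v)) :=
    chartRing_isNoetherian ⟨{v}, by simp [rayCone]⟩
  have hsp := rayIdeal_eq_span (k := k) (m := m') hm
  have hp := rayIdeal_isPrime (k := k) v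
  rw [hsp] at hp ⊢
  refine Ideal.height_span_singleton_eq_one_of_mem_nonZeroDivisors ?_ ?_
  · exact mem_nonZeroDivisors_of_ne_zero fun h => by
      simpa using congrArg (fun f => f.coeff m') h
  · exact fun h => hp.ne_top (Ideal.span_singleton_eq_top.2 h)

/-- The generic point of `Y(v)` in the chart `U_ρ`. -/
def rayPoint (v : N) : Spec (.of (ChartRing k (rayCone v))) :=
  (⟨rayIdeal k v, rayIdeal_isPrime v⟩ : PrimeSpectrum (ChartRing k (rayCone v)))

variable (k) in
/-- The torus-invariant prime divisor `Y(v)` of a ray `v ∈ Δ(1)`. -/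
def rayDivisor {Δ : Fan N} (ρ : Δ.Ray) : PrimeDivisor (toricVariety k Δ) :=
  ⟨chartι k ρ.cone (rayPoint ρ.gen), by
    refine (coheight_eq_of_isOpenImmersion (chartι k ρ.cone)).trans ?_
    have h2 := idealHeight_eq_coheight (.of (ChartRing k (rayCone ρ.gen))) (rayPoint ρ.gen)
    exact h2.symm.trans (rayIdeal_height ρ.isPrimitive)⟩

variable (k) in
/-- The Cox ring of `X(Δ)`: the polynomial ring with one variable for each ray. -/
abbrev CoxRing (Δ : Fan N) : Type u := MvPolynomial Δ.Ray k

variable (k) in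
/-- The degree `[Y(v)] ∈ Cl(X)` of the variable `v`. -/
def coxDegree {Δ : Fan N} (ρ : Δ.Ray) : DivisorClassGroup (toricVariety k Δ) :=
  QuotientAddGroup.mk (Finsupp.single (rayDivisor k ρ) 1)

/-- The graded piece of the Cox ring of degree `c ∈ Cl(X)`. -/
def coxGradedPiece {Δ : Fan N} (c : DivisorClassGroup (toricVariety k Δ)) :
    Submodule k (CoxRing k Δ) :=
  MvPolynomial.weightedHomogeneousSubmodule k (coxDegree k) c

end Rays

end Toric

end

/-!
Both spaces have a basis indexed by the lattice points `u` of the polyhedron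
`P_D = {u | ⟨u, v_i⟩ ≥ -a_i}`: the characters `x^u` on the side of the sections, the monomials
`∏ v_i ^ (⟨u, v_i⟩ + a_i)` on the side of the Cox ring.

A prime divisor that meets the torus does not occur in an invariant divisor, since it has
infinitely many translates under `T(k)`: a nonzero ideal of `k[M]` with finitely many translates is
stable under enough of the torus to contain a character, and is then the unit ideal. A prime
divisor that misses the torus is one of the `Y(v_i)`, because its ideal in a chart contains the
ideal of a ray and both have height one.

A section of `𝒪(D)` has no poles on the torus, hence is a Laurent polynomial, `k[M]` being
factorial. Its order along `Y(v_i)` is the smallest `⟨u, v_i⟩` among the characters `x^u` occurring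
in it, so all of these lie in `P_D`. A rational function without zeros and poles on the torus is a
unit of `k[M]`, that is, a multiple of a character. Therefore `∑ d_i Y(v_i)` is linearly equivalent
to `D` if and only if `d_i = ⟨u, v_i⟩ + a_i` for some `u`, and non-degeneracy makes `u` unique.
-/

noncomputable section

namespace Toric

open CategoryTheory CategoryTheory.Limits AlgebraicGeometry

universe u

section Cones

lemma exists_subset_span_eq_irredundant {R M : Type*} [Semiring R] [AddCommMonoid M] [Module R M]
    {S : Set M} (hS : S.Finite) :
    ∃ T ⊆ S, Submodule.span R T = Submodule.span R S ∧
      ∀ t ∈ T, t ∉ Submodule.span R (T \ {t}) := by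
  obtain ⟨T, ⟨hTS, hT⟩, hmin⟩ := (hS.finite_subsets.subset
    (Set.sep_subset _ fun T => Submodule.span R T = Submodule.span R S)).exists_minimal
    ⟨S, Set.Subset.rfl, rfl⟩
  refine ⟨T, hTS, hT, fun t ht hmem => ?_⟩
  have hspan : Submodule.span R (T \ {t}) = Submodule.span R S := by
    rw [← hT, ← Submodule.span_insert_eq_span hmem, Set.insert_sdiff_self_of_mem ht]
  exact (hmin ⟨Set.sdiff_subset.trans hTS, hspan⟩ Set.sdiff_subset ht).2 rfl

section RealSpace

variable {V : Type*} [AddCommGroup V] [Module ℝ V]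

lemma eq_zero_of_mem_hull {S : Set V} {w : V →ₗ[ℝ] ℝ} (hw : ∀ s ∈ S, w s = 0) {x : V}
    (hx : x ∈ PointedCone.hull ℝ S) : w x = 0 :=
  (Submodule.span_le.2 hw : PointedCone.hull ℝ S ≤ (LinearMap.ker w).restrictScalars _) hx

lemma disjoint_convexHull_span_singleton {T : Set V} {s : V} {l : V →ₗ[ℝ] ℝ} (hs : 0 < l s)
    (hl : ∀ t ∈ T, 0 < l t) (hsT : s ∉ PointedCone.hull ℝ T) :
    Disjoint (convexHull ℝ T) (ℝ ∙ s) := by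
  rw [Set.disjoint_left]
  intro x hx hxs
  obtain ⟨a, rfl⟩ := Submodule.mem_span_singleton.1 hxs
  have hlx : 0 < l (a • s) :=
    convexHull_min (t := {x | 0 < l x}) hl (convex_halfSpace_gt l.isLinear 0) hx
  have ha : 0 < a := pos_of_mul_pos_left (by simpa using hlx) hs.le
  have hxT : a • s ∈ PointedCone.hull ℝ T :=
    convexHull_min PointedCone.subset_hull (PointedCone.hull ℝ T).convex hx
  exact hsT (by simpa [smul_smul, ha.ne'] using
    (PointedCone.hull ℝ T).smul_mem (inv_pos.2 ha).le hxT)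

lemma exists_pos_on_and_eq_zero_of_disjoint {E : Type*} [NormedAddCommGroup E] [NormedSpace ℝ E]
    {T : Set E} (hT : T.Finite) {s : E}
    (hdisj : Disjoint (convexHull ℝ T) (ℝ ∙ s)) :
    ∃ w : E →ₗ[ℝ] ℝ, w s = 0 ∧ ∀ t ∈ T, 0 < w t := by
  let C : ProperCone ℝ E :=
    { toSubmodule := (ℝ ∙ s).restrictScalars _
      isClosed' := Submodule.closed_of_finiteDimensional (ℝ ∙ s) }
  obtain ⟨f, hfC, hfT⟩ := C.hyperplane_separation (convex_convexHull ℝ _)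
    (hT.isCompact_convexHull (𝕜 := ℝ)) hdisj
  have hs : 0 ≤ f s := hfC s (Submodule.mem_span_singleton_self s)
  have hs' : 0 ≤ f (-s) := hfC (-s) ((ℝ ∙ s).neg_mem (Submodule.mem_span_singleton_self s))
  refine ⟨-(f : E →ₗ[ℝ] ℝ), ?_, fun t ht => neg_pos.2 (hfT t (subset_convexHull ℝ _ ht))⟩
  rw [map_neg] at hs'
  exact neg_eq_zero.2 (by linarith : f s = 0)

lemma exists_pos_on_and_eq_zero [FiniteDimensional ℝ V] {T : Set V} (hT : T.Finite) {s : V}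
    {l : V →ₗ[ℝ] ℝ} (hs : 0 < l s) (hl : ∀ t ∈ T, 0 < l t) (hsT : s ∉ PointedCone.hull ℝ T) :
    ∃ w : V →ₗ[ℝ] ℝ, w s = 0 ∧ ∀ t ∈ T, 0 < w t := by
  let e := (Module.finBasis ℝ V).equivFun
  let _ : NormedAddCommGroup V := .induced V _ e e.injective
  let _ : NormedSpace ℝ V := .induced ℝ V _ e
  exact exists_pos_on_and_eq_zero_of_disjoint hT (disjoint_convexHull_span_singleton hs hl hsT)

end RealSpace

variable {N : Type} [AddCommGroup N]

lemma isFace_hull {S : Set N} {w : RealSpan N →ₗ[ℝ] ℝ} (hw : ∀ s ∈ S, 0 ≤ w (toReal s)) :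
    IsFace (PointedCone.hull ℝ (toReal '' {s ∈ S | w (toReal s) = 0}))
      (PointedCone.hull ℝ (toReal '' S)) := by
  refine ⟨w, nonneg_on_hull hw, fun x => ⟨fun hx => ⟨?_, ?_⟩, fun hx => ?_⟩⟩
  · exact Submodule.span_mono (Set.image_mono (Set.sep_subset _ _)) hx
  · exact eq_zero_of_mem_hull (by rintro _ ⟨s, hs, rfl⟩; exact hs.2) hx
  · exact mem_hull_of_eq_zero hw x hx.1 hx.2

lemma toReal_zsmul (n : ℤ) (v : N) : toReal (n • v) = (n : ℝ) • toReal v := by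
  rw [toReal, toReal, TensorProduct.tmul_smul, Int.cast_smul_eq_zsmul]

lemma toReal_mem_rayCone (v : N) : toReal v ∈ rayCone v := toReal_mem_hull rfl

lemma rayCone_le_iff {v : N} {σ : PointedCone ℝ (RealSpan N)} : rayCone v ≤ σ ↔ toReal v ∈ σ := by
  rw [rayCone, Set.image_singleton, PointedCone.hull, Submodule.span_singleton_le_iff_mem]

lemma rayCone_zsmul {n : ℤ} (hn : 0 < n) (v : N) : rayCone (n • v) = rayCone v := by
  have hn' : (0 : ℝ) < n := Int.cast_pos.2 hn
  apply le_antisymm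
  · rw [rayCone_le_iff, toReal_zsmul]
    exact (rayCone v).smul_mem hn'.le (toReal_mem_rayCone v)
  · rw [rayCone_le_iff, ← inv_smul_smul₀ hn'.ne' (toReal v), ← toReal_zsmul]
    exact (rayCone (n • v)).smul_mem (inv_pos.2 hn').le (toReal_mem_rayCone _)

lemma IsPrimitive.neg {v : N} (hv : IsPrimitive v) : IsPrimitive (-v) := fun n w h =>
  (IsUnit.neg_iff n).1 (hv (-n) w (by rw [neg_smul, ← h, neg_neg]))

lemma exists_isPrimitive_mem_span [Module.Finite ℤ N] [Module.IsTorsionFree ℤ N] {s : N}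
    (hs : s ≠ 0) : ∃ v : N, IsPrimitive v ∧ s ∈ ℤ ∙ v := by
  obtain ⟨v, hv, hmax⟩ := exists_maximalFor_of_wellFoundedGT (fun v : N => s ∈ ℤ ∙ v)
    (fun v => ℤ ∙ v) ⟨s, Submodule.mem_span_singleton_self s⟩
  refine ⟨v, fun n w hvw => ?_, hv⟩
  have hw : ℤ ∙ v ≤ ℤ ∙ w :=
    (Submodule.span_singleton_le_iff_mem _ _).2 (Submodule.mem_span_singleton.2 ⟨n, hvw.symm⟩)
  obtain ⟨c, hc⟩ := Submodule.mem_span_singleton.1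
    (hmax (hw hv) hw (Submodule.mem_span_singleton_self w))
  have hw0 : w ≠ 0 := fun h => hs (by simpa [h] using hw hv)
  have hcn : c * n = 1 := smul_left_injective ℤ hw0 (by
    simp only [mul_smul, one_smul, ← hvw, hc])
  exact .of_mul_eq_one_right _ hcn

lemma exists_isPrimitive [Module.Finite ℤ N] [Module.IsTorsionFree ℤ N] {s : N} (hs : s ≠ 0) :
    ∃ (n : ℤ) (v : N), 0 < n ∧ IsPrimitive v ∧ s = n • v := by
  obtain ⟨v, hv, hsv⟩ := exists_isPrimitive_mem_span hs
  obtain ⟨n, rfl⟩ := Submodule.mem_span_singleton.1 hsv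
  rcases lt_trichotomy n 0 with hn | rfl | hn
  · exact ⟨-n, -v, neg_pos.2 hn, hv.neg, (neg_smul_neg n v).symm⟩
  · exact absurd (zero_smul ℤ v) hs
  · exact ⟨n, v, hn, hv, rfl⟩

lemma isFace_rayCone_of_irredundant [Module.Finite ℤ N] {S : Set N} (hS : S.Finite)
    {l : RealSpan N →ₗ[ℝ] ℝ} (hl : ∀ s ∈ S, 0 < l (toReal s)) {s : N} (hs : s ∈ S)
    (hirr : toReal s ∉ PointedCone.hull ℝ (toReal '' S \ {toReal s})) :
    IsFace (rayCone s) (PointedCone.hull ℝ (toReal '' S)) := by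
  obtain ⟨w, hws, hw⟩ := exists_pos_on_and_eq_zero (hS.image toReal).sdiff (hl s hs)
    (by rintro _ ⟨⟨t, ht, rfl⟩, -⟩; exact hl t ht) hirr
  have hw' : ∀ t ∈ S, toReal t ≠ toReal s → 0 < w (toReal t) := fun t ht hts =>
    hw _ ⟨⟨t, ht, rfl⟩, hts⟩
  have hnonneg : ∀ t ∈ S, 0 ≤ w (toReal t) := fun t ht => by
    by_cases hts : toReal t = toReal s
    · rw [hts, hws]
    · exact (hw' t ht hts).le
  have hzero : toReal '' {t ∈ S | w (toReal t) = 0} = toReal '' {s} := by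
    rw [Set.image_singleton]
    refine Set.Subset.antisymm ?_ (Set.singleton_subset_iff.2 ⟨s, ⟨hs, hws⟩, rfl⟩)
    rintro _ ⟨t, ⟨ht, hwt⟩, rfl⟩
    by_contra hts
    exact (hw' t ht hts).ne' hwt
  rw [rayCone, ← hzero]
  exact isFace_hull hnonneg

/-- The set of primitive generators of the rays of `Δ` contained in the cone `σ`. -/
def Fan.rayGenerators (Δ : Fan N) (σ : Δ.Cone) : Set N :=
  {v | ∃ ρ : Δ.Ray, ρ.gen = v ∧ ρ.cone ≤ σ}

lemma Fan.exists_pos_on (Δ : Fan N) (σ : Δ.Cone) :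
    ∃ l : RealSpan N →ₗ[ℝ] ℝ, ∀ x ∈ σ.1, x ≠ 0 → 0 < l x := by
  obtain ⟨l, hl, hl0⟩ := Δ.isFace_of_le (Δ.zeroCone_le σ)
  refine ⟨l, fun x hx hx0 => (hl x hx).lt_of_ne fun h => hx0 ?_⟩
  exact (Submodule.mem_bot _).1 ((hl0 x).2 ⟨hx, h.symm⟩)

lemma Fan.exists_generators_isFace_rayCone [Module.Finite ℤ N] (Δ : Fan N) (σ : Δ.Cone) :
    ∃ S : Set N, σ.1 = PointedCone.hull ℝ (toReal '' S) ∧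
      ∀ s ∈ S, s ≠ 0 ∧ IsFace (rayCone s) σ.1 := by
  obtain ⟨S₀, hS₀⟩ := Δ.rational _ σ.2
  obtain ⟨l, hl⟩ := Δ.exists_pos_on σ
  obtain ⟨T, hT, hspan, hirr⟩ := exists_subset_span_eq_irredundant (R := {c : ℝ // 0 ≤ c})
    (S₀.finite_toSet.image toReal)
  obtain ⟨S, hS, rfl⟩ := Set.subset_image_iff.1 hT
  have hσ : σ.1 = PointedCone.hull ℝ (toReal '' S) := hS₀.trans hspan.symm
  have hne : ∀ s ∈ S, toReal s ≠ 0 := fun s hs h0 =>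
    hirr _ ⟨s, hs, rfl⟩ (h0 ▸ Submodule.zero_mem _)
  have hpos : ∀ s ∈ S, 0 < l (toReal s) := fun s hs =>
    hl _ (hσ ▸ toReal_mem_hull hs) (hne s hs)
  refine ⟨S, hσ, fun s hs => ⟨fun h => hne s hs (by rw [h, toReal, TensorProduct.tmul_zero]), ?_⟩⟩
  rw [hσ]
  exact isFace_rayCone_of_irredundant (S₀.finite_toSet.subset hS) hpos hs (hirr _ ⟨s, hs, rfl⟩)

lemma Fan.exists_ray_of_isFace_rayCone [Module.Finite ℤ N] [Module.IsTorsionFree ℤ N] (Δ : Fan N)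
    {σ : Δ.Cone} {s : N} (hs : s ≠ 0) (hface : IsFace (rayCone s) σ.1) :
    ∃ (n : ℤ) (ρ : Δ.Ray), 0 < n ∧ ρ.cone ≤ σ ∧ s = n • ρ.gen := by
  obtain ⟨n, v, hn, hv, rfl⟩ := exists_isPrimitive hs
  rw [rayCone_zsmul hn] at hface
  have hle : rayCone v ≤ σ.1 := fun x hx => by
    obtain ⟨w, -, hw⟩ := hface
    exact ((hw x).1 hx).1
  exact ⟨n, ⟨v, hv, Δ.face_mem _ σ.2 _ hface⟩, hn, hle, rfl⟩

lemma Fan.cone_eq_hull_rayGenerators [Module.Finite ℤ N] [Module.IsTorsionFree ℤ N] (Δ : Fan N)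
    (σ : Δ.Cone) : σ.1 = PointedCone.hull ℝ (toReal '' Δ.rayGenerators σ) := by
  obtain ⟨S, hσ, hS⟩ := Δ.exists_generators_isFace_rayCone σ
  apply le_antisymm
  · rw [hσ]
    refine Submodule.span_le.2 ?_
    rintro _ ⟨s, hs, rfl⟩
    obtain ⟨n, ρ, hn, hρ, rfl⟩ := Δ.exists_ray_of_isFace_rayCone (hS s hs).1 (hS s hs).2
    rw [toReal_zsmul]
    exact PointedCone.smul_mem _ (Int.cast_nonneg hn.le) (toReal_mem_hull ⟨ρ, rfl, hρ⟩)
  · refine Submodule.span_le.2 ?_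
    rintro _ ⟨_, ⟨ρ, rfl, hρ⟩, rfl⟩
    exact hρ (toReal_mem_rayCone ρ.gen)

lemma Fan.IsNondegenerate.eq_of_rays [Module.Finite ℤ N] [Module.IsTorsionFree ℤ N] {Δ : Fan N}
    (hΔ : Δ.IsNondegenerate) {u w : DualLattice N} (h : ∀ ρ : Δ.Ray, u ρ.gen = w ρ.gen) :
    u = w := by
  have hσ : ∀ σ ∈ Δ.cones, (σ : Set (RealSpan N)) ⊆ LinearMap.ker (realFunctional (u - w)) := by
    intro σ hσ x hx
    rw [SetLike.mem_coe, show σ = _ from Δ.cone_eq_hull_rayGenerators ⟨σ, hσ⟩] at hx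
    refine eq_zero_of_mem_hull ?_ hx
    rintro _ ⟨_, ⟨ρ, rfl, -⟩, rfl⟩
    simp [h ρ]
  have hker : LinearMap.ker (realFunctional (u - w)) = ⊤ :=
    top_le_iff.1 (hΔ.symm.trans_le (Submodule.span_le.2 (Set.iUnion₂_subset hσ)))
  ext v
  have hv : realFunctional (u - w) (toReal v) = 0 := hker.ge Submodule.mem_top
  rw [realFunctional_toReal, Int.cast_eq_zero] at hv
  exact sub_eq_zero.1 hv

end Cones

section MonoidAlgebras

section Units

variable {R G : Type*} [Semiring R] [NoZeroDivisors R] [AddMonoid G]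

lemma add_eq_zero_of_uniqueAdd_of_mul_eq_one {f g : AddMonoidAlgebra R G} (h : f * g = 1) {a b : G}
    (ha : a ∈ f.coeff.support) (hb : b ∈ g.coeff.support)
    (hab : UniqueAdd f.coeff.support g.coeff.support a b) : a + b = 0 := by
  classical
  have hcoeff := AddMonoidAlgebra.coeff_mul_add_of_uniqueAdd hab
  rw [h, AddMonoidAlgebra.one_def, AddMonoidAlgebra.coeff_single, Finsupp.single_apply] at hcoeff
  by_contra hne
  rw [if_neg (Ne.symm hne)] at hcoeff
  exact mul_ne_zero (Finsupp.mem_support_iff.1 ha) (Finsupp.mem_support_iff.1 hb) hcoeff.symm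

lemma exists_eq_single_of_isUnit [Nontrivial R] [TwoUniqueSums G] {f : AddMonoidAlgebra R G}
    (hf : IsUnit f) : ∃ (u : G) (c : R), c ≠ 0 ∧ f = AddMonoidAlgebra.single u c := by
  obtain ⟨g, hfg⟩ := hf.exists_right_inv
  have hf0 : 0 < f.coeff.support.card := by
    rw [Finset.card_pos, Finsupp.support_nonempty_iff]
    rintro h
    simp [AddMonoidAlgebra.coeff_injective h] at hfg
  have hg0 : 0 < g.coeff.support.card := by
    rw [Finset.card_pos, Finsupp.support_nonempty_iff]
    rintro h
    simp [AddMonoidAlgebra.coeff_injective h] at hfg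
  have hcard : f.coeff.support.card = 1 := by
    by_contra hne
    obtain ⟨p, hp, q, hq, hpq, hup, huq⟩ := TwoUniqueSums.uniqueAdd_of_one_lt_card
      (Nat.one_lt_mul_iff.2 ⟨hf0, hg0, Or.inl (by omega)⟩)
    rw [Finset.mem_product] at hp hq
    have hp0 := add_eq_zero_of_uniqueAdd_of_mul_eq_one hfg hp.1 hp.2 hup
    have hq0 := add_eq_zero_of_uniqueAdd_of_mul_eq_one hfg hq.1 hq.2 huq
    have heq := hup hq.1 hq.2 (hq0.trans hp0.symm)
    exact hpq (Prod.ext heq.1.symm heq.2.symm)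
  obtain ⟨u, c, hc, hfu⟩ := Finsupp.card_support_eq_one'.1 hcard
  exact ⟨u, c, hc, AddMonoidAlgebra.coeff_injective hfu⟩

end Units

section Factorial

variable {R : Type*} [CommRing R] [UniqueFactorizationMonoid R]

lemma exists_algebraMap_eq_of_forall_prime [IsDomain R] {K : Type*} [Field K] [Algebra R K]
    [IsFractionRing R K] {f : K}
    (h : ∀ p : R, Prime p → ∃ a b : R, ¬ p ∣ b ∧ f * algebraMap R K b = algebraMap R K a) :
    ∃ a, algebraMap R K a = f := by
  refine IsFractionRing.isInteger_of_isUnit_den (A := R) ?_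
  by_contra hden
  obtain ⟨p, hp, hpd⟩ := WfDvdMonoid.exists_irreducible_factor hden (nonZeroDivisors.coe_ne_zero _)
  obtain ⟨a, b, hb, hab⟩ := h p hp.prime
  have hf : f * algebraMap R K (IsFractionRing.den R f) =
      algebraMap R K (IsFractionRing.num R f) := by
    rw [← IsLocalization.eq_mk'_iff_mul_eq, IsFractionRing.mk'_num_den]
  have hcross : IsFractionRing.num R f * b = a * IsFractionRing.den R f :=
    IsFractionRing.injective R K (by rw [map_mul, map_mul, ← hab, mul_right_comm, hf])
  have hpn : p ∣ IsFractionRing.num R f :=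
    (hp.prime.dvd_or_dvd (hcross ▸ hpd.mul_left a)).resolve_right hb
  exact hp.not_isUnit (IsFractionRing.num_den_reduced R f hpn hpd)

lemma uniqueFactorizationMonoid_addMonoidAlgebra_fin (n : ℕ) :
    UniqueFactorizationMonoid (AddMonoidAlgebra R (Fin n → ℤ)) := by
  induction n with
  | zero =>
    exact (AddMonoidAlgebra.uniqueRingEquiv (R := R)
      (Fin 0 → ℤ)).symm.toMulEquiv.uniqueFactorizationMonoid inferInstance
  | succ n ih =>
    have hlaurent :
        UniqueFactorizationMonoid (LaurentPolynomial (AddMonoidAlgebra R (Fin n → ℤ))) :=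
      .of_isLocalization
        (Submonoid.powers (Polynomial.X : Polynomial (AddMonoidAlgebra R (Fin n → ℤ)))) _
    let e : LaurentPolynomial (AddMonoidAlgebra R (Fin n → ℤ)) ≃+*
        AddMonoidAlgebra R (Fin (n + 1) → ℤ) :=
      AddMonoidAlgebra.curryRingEquiv.symm.trans
        (AddMonoidAlgebra.mapDomainRingEquiv R (Fin.consLinearEquiv ℤ fun _ => ℤ).toAddEquiv)
    exact e.toMulEquiv.uniqueFactorizationMonoid hlaurent

lemma uniqueFactorizationMonoid_addMonoidAlgebra {M : Type*} [AddCommGroup M] [Module.Finite ℤ M]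
    [Module.Free ℤ M] : UniqueFactorizationMonoid (AddMonoidAlgebra R M) :=
  (AddMonoidAlgebra.mapDomainRingEquiv R
    (Module.finBasis ℤ M).equivFun.symm.toAddEquiv).toMulEquiv.uniqueFactorizationMonoid
    (uniqueFactorizationMonoid_addMonoidAlgebra_fin _)

end Factorial

section Stable

variable {k G : Type*} [Field k]

lemma support_ssubset_of_apply_eq_sub_mul {f g : G →₀ k} {χ : G → k} {u : G}
    (hg : ∀ w, g w = (χ w - χ u) * f w) (hu : f u ≠ 0) : g.support ⊂ f.support := by
  refine ⟨fun w hw => ?_, fun hsub => ?_⟩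
  · rw [Finsupp.mem_support_iff, hg] at hw
    exact Finsupp.mem_support_iff.2 (right_ne_zero_of_mul hw)
  · refine Finsupp.mem_support_iff.1 (hsub (Finsupp.mem_support_iff.2 hu)) ?_
    rw [hg, sub_self, zero_mul]

lemma exists_single_mem_of_stable {V : Submodule k (AddMonoidAlgebra k G)} (hV : V ≠ ⊥)
    (h : ∀ u w : G, u ≠ w → ∃ χ : G → k, χ u ≠ χ w ∧
      ∀ f ∈ V, ∃ g ∈ V, ∀ w, g.coeff w = χ w * f.coeff w) :
    ∃ u : G, AddMonoidAlgebra.single u (1 : k) ∈ V := by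
  -- For `f ∈ V` of minimal support, twisting by `χ` and subtracting `χ u • f` kills the `u`-term.
  obtain ⟨f, ⟨hfV, hf0⟩, hmin⟩ := exists_minimalFor_of_wellFoundedLT
    (fun f => f ∈ V ∧ f ≠ 0) (fun f => f.coeff.support) (Submodule.exists_mem_ne_zero_of_ne_bot hV)
  obtain ⟨u, hu⟩ : ∃ u, f.coeff u ≠ 0 :=
    Finsupp.ne_iff.1 fun h0 => hf0 (AddMonoidAlgebra.coeff_injective h0)
  have hsupp : ∀ w, w ≠ u → f.coeff w = 0 := by
    intro w hw
    by_contra hfw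
    obtain ⟨χ, hχ, hstable⟩ := h w u hw
    obtain ⟨g, hgV, hg⟩ := hstable f hfV
    have hd : ∀ v, (g - χ u • f).coeff v = (χ v - χ u) * f.coeff v := fun v => by
      simp [hg, sub_mul]
    have hd0 : g - χ u • f ≠ 0 := fun h0 =>
      mul_ne_zero (sub_ne_zero.2 hχ) hfw (by rw [← hd, h0, AddMonoidAlgebra.coeff_zero]; rfl)
    have hlt := support_ssubset_of_apply_eq_sub_mul hd hu
    exact hlt.2 (hmin ⟨V.sub_mem hgV (V.smul_mem _ hfV), hd0⟩ hlt.1)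
  have hf : f = f.coeff u • AddMonoidAlgebra.single u 1 := by
    rw [AddMonoidAlgebra.smul_single', mul_one]
    exact AddMonoidAlgebra.coeff_injective (Finsupp.support_subset_singleton.1 fun w hw =>
      Finset.mem_singleton.2 (by_contra fun hne => Finsupp.mem_support_iff.1 hw (hsupp w hne)))
  exact ⟨u, (V.smul_mem_iff hu).1 (hf ▸ hfV)⟩

end Stable

end MonoidAlgebras

section ChartRings

variable {k : Type u} [Field k] {N : Type} [AddCommGroup N]

instance [Module.Finite ℤ N] [Module.Free ℤ N] (σ : PointedCone ℝ (RealSpan N)) :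
    TwoUniqueSums (dualMonoid σ) :=
  .of_injective_addHom ((dualMonoid σ).subtype : dualMonoid σ →ₙ+ DualLattice N)
    Subtype.val_injective UniqueSums.toTwoUniqueSums_of_addGroup

/-- The semigroup of the zero cone is the whole dual lattice. -/
def dualMonoidBotEquiv : dualMonoid (⊥ : PointedCone ℝ (RealSpan N)) ≃+ DualLattice N where
  toFun u := u
  invFun u := ⟨u, mem_dualMonoid_bot u⟩
  left_inv _ := rfl
  right_inv _ := rfl
  map_add' _ _ := rfl

instance [Module.Finite ℤ N] [Module.Free ℤ N] :
    UniqueFactorizationMonoid (ChartRing k (⊥ : PointedCone ℝ (RealSpan N))) :=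
  (AddMonoidAlgebra.mapDomainRingEquiv k dualMonoidBotEquiv.symm).toMulEquiv
    |>.uniqueFactorizationMonoid uniqueFactorizationMonoid_addMonoidAlgebra

/-- The character `x^u`, `u ∈ M`, as a function on the torus. -/
def torusMonomial (k : Type u) [Field k] (u : DualLattice N) :
    ChartRing k (⊥ : PointedCone ℝ (RealSpan N)) :=
  AddMonoidAlgebra.single ⟨u, mem_dualMonoid_bot u⟩ 1

lemma isUnit_torusMonomial (u : DualLattice N) : IsUnit (torusMonomial k u) := by
  refine .of_mul_eq_one (torusMonomial k (-u)) ?_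
  simp only [torusMonomial, AddMonoidAlgebra.single_mul_single, AddMonoidAlgebra.one_def, one_mul,
    AddMemClass.mk_add_mk, add_neg_cancel]
  rfl

end ChartRings

section TorusAction

variable {k : Type u} [Field k]

instance [Infinite k] : Infinite kˣ :=
  have := Set.infinite_coe_iff.2 (Set.finite_singleton (0 : k)).infinite_compl
  unitsEquivNeZero.infinite_iff.2 this

lemma finite_setOf_zpow_eq_one {R : Type*} [CommRing R] [IsDomain R] {m : ℤ} (hm : m ≠ 0) :
    {c : Rˣ | c ^ m = 1}.Finite := by
  have : NeZero m.natAbs := ⟨Int.natAbs_ne_zero.2 hm⟩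
  have hroots : Finite (rootsOfUnity m.natAbs R) := inferInstance
  refine (show (rootsOfUnity m.natAbs R : Set Rˣ).Finite from hroots).subset
    fun c (hc : c ^ m = 1) => ?_
  rw [SetLike.mem_coe, mem_rootsOfUnity, ← zpow_natCast, Int.natCast_natAbs]
  rcases abs_choice m with h | h
  · rw [h, hc]
  · rw [h, zpow_neg, hc, inv_one]

lemma exists_eq_and_div_notMem {G α : Type*} [Group G] [Infinite G] {F : G → α}
    (hF : (Set.range F).Finite) {A : Set G} (hA : A.Finite) :
    ∃ c d, F c = F d ∧ c / d ∉ A := by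
  have := hF.to_subtype
  obtain ⟨y, hy⟩ := Finite.exists_infinite_fiber (Set.rangeFactorization F)
  rw [Set.infinite_coe_iff] at hy
  obtain ⟨d, hd⟩ := hy.nonempty
  obtain ⟨c, hc, hcA⟩ := hy.exists_notMem_finite (hA.image (· * d))
  exact ⟨c, d, congrArg Subtype.val (hc.trans hd.symm),
    fun h => hcA ⟨c / d, h, div_mul_cancel c d⟩⟩

variable {N : Type} [AddCommGroup N]

lemma chartAction_coeff (t : TorusPoint k N) (σ : PointedCone ℝ (RealSpan N)) (f : ChartRing k σ)
    (u : dualMonoid σ) : (chartAction t σ f).coeff u =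
      t (Multiplicative.ofAdd (u : DualLattice N)) * f.coeff u := by
  classical
  induction f using AddMonoidAlgebra.induction_linear with
  | zero => simp
  | add f g hf hg => simp [hf, hg, mul_add]
  | single w c =>
    rw [chartAction_single, AddMonoidAlgebra.coeff_single, AddMonoidAlgebra.coeff_single,
      Finsupp.single_apply, Finsupp.single_apply]
    split_ifs with h
    · rw [h, mul_comm]
    · simp

lemma chartAction_mul_apply (s t : TorusPoint k N) (σ : PointedCone ℝ (RealSpan N))
    (f : ChartRing k σ) : chartAction (s * t) σ f = chartAction s σ (chartAction t σ f) := by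
  refine AddMonoidAlgebra.coeff_injective (Finsupp.ext fun u => ?_)
  simp [chartAction_coeff, mul_assoc]

lemma chartAction_one_apply (σ : PointedCone ℝ (RealSpan N)) (f : ChartRing k σ) :
    chartAction (1 : TorusPoint k N) σ f = f := by
  refine AddMonoidAlgebra.coeff_injective (Finsupp.ext fun u => ?_)
  simp [chartAction_coeff]

/-- The action of a point of the torus on a coordinate ring `k[σ^∨ ∩ M]`, as an automorphism. -/
def chartActionEquiv (t : TorusPoint k N) (σ : PointedCone ℝ (RealSpan N)) :
    ChartRing k σ ≃ₐ[k] ChartRing k σ :=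
  .ofAlgHom (chartAction t σ) (chartAction t⁻¹ σ)
    (AlgHom.ext fun f => by
      rw [AlgHom.comp_apply, ← chartAction_mul_apply, mul_inv_cancel t, chartAction_one_apply,
        AlgHom.id_apply])
    (AlgHom.ext fun f => by
      rw [AlgHom.comp_apply, ← chartAction_mul_apply, inv_mul_cancel t, chartAction_one_apply,
        AlgHom.id_apply])

/-- The one-parameter subgroup `k^* → T(k)` of `v ∈ N`, `c ↦ (u ↦ c ^ ⟨u, v⟩)`. -/
def oneParameter (v : N) : kˣ →* TorusPoint k N where
  toFun c :=
    { toFun := fun u => c ^ u.toAdd v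
      map_one' := by simp
      map_mul' := fun u w => by simp [zpow_add] }
  map_one' := by ext; simp
  map_mul' c d := by ext; simp [mul_zpow]

lemma oneParameter_apply (v : N) (c : kˣ) (u : DualLattice N) :
    oneParameter v c (Multiplicative.ofAdd u) = c ^ u v := rfl

lemma exists_infinite_translates [Infinite k]
    {P : Ideal (ChartRing k (⊥ : PointedCone ℝ (RealSpan N)))} (hP : P ≠ ⊥) (hP' : P ≠ ⊤) :
    ∃ v : N, (Set.range fun c : kˣ => P.comap (chartAction (oneParameter v c) ⊥)).Infinite := by
  by_contra! hfin
  obtain ⟨u, hu⟩ := exists_single_mem_of_stable (V := P.restrictScalars k)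
    (by rwa [Ne, Submodule.restrictScalars_eq_bot_iff]) fun u w huw => by
      obtain ⟨v, hv⟩ : ∃ v, u.1 v ≠ w.1 v := by
        by_contra! h
        exact huw (Subtype.ext (LinearMap.ext h))
      obtain ⟨c, d, hcd, hroot⟩ := exists_eq_and_div_notMem (hfin v)
        (finite_setOf_zpow_eq_one (R := k) (sub_ne_zero.2 hv))
      refine ⟨fun x => oneParameter v (c / d) (Multiplicative.ofAdd x.1), fun h => hroot ?_,
        fun f hf => ⟨chartAction (oneParameter v (c / d)) ⊥ f, ?_, chartAction_coeff _ ⊥ f⟩⟩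
      · have h := Units.ext h
        rw [oneParameter_apply, oneParameter_apply] at h
        change (c / d) ^ (u.1 v - w.1 v) = 1
        rw [zpow_sub, h, mul_inv_cancel]
      · have hmem : chartAction (oneParameter v d⁻¹) ⊥ f ∈
            P.comap (chartAction (oneParameter v d) ⊥) := by
          rw [Ideal.mem_comap, ← chartAction_mul_apply, ← map_mul, mul_inv_cancel, map_one,
            chartAction_one_apply]
          exact hf
        rw [← show P.comap (chartAction (oneParameter v c) ⊥) = _ from hcd, Ideal.mem_comap,
          ← chartAction_mul_apply, ← map_mul, ← div_eq_mul_inv] at hmem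
        exact hmem
  exact hP' (P.eq_top_of_isUnit_mem hu (isUnit_torusMonomial u.1))

end TorusAction

section AffineCharts

section PointIdeal

variable {R : Type u} [CommRing R]

/-- The prime ideal of a point of the affine scheme `Spec R`. -/
def pointIdeal (y : Spec (.of R)) : Ideal R :=
  PrimeSpectrum.asIdeal (R := R) y

instance pointIdeal_isPrime (y : Spec (.of R)) : (pointIdeal y).IsPrime :=
  PrimeSpectrum.isPrime (R := R) y

lemma pointIdeal_injective : Function.Injective (pointIdeal (R := R)) := fun _ _ h =>
  PrimeSpectrum.ext (R := R) h

end PointIdeal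

variable {R : Type u} [CommRing R] {X : Scheme.{u}} (j : Spec (.of R) ⟶ X) [IsOpenImmersion j]

lemma coheight_eq_height_pointIdeal (y : Spec (.of R)) :
    Order.coheight (j y) = (pointIdeal y).height :=
  (coheight_eq_of_isOpenImmersion j).trans (idealHeight_eq_coheight (.of R) y).symm

lemma apply_mem_image_top (y : Spec (.of R)) : j y ∈ j ''ᵁ ⊤ :=
  ⟨y, trivial, rfl⟩

/-- The homomorphism from the coordinate ring `R` of an affine open subscheme of `X` to the local
ring of `X` at one of its points. -/
def specToStalk (y : Spec (.of R)) : R →+* X.presheaf.stalk (j y) :=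
  ((Scheme.ΓSpecIso (.of R)).inv ≫ (j.appIso ⊤).inv ≫
    X.presheaf.germ (j ''ᵁ ⊤) (j y) (apply_mem_image_top j y)).hom

lemma ofHom_specToStalk_stalkMap (y : Spec (.of R)) :
    CommRingCat.ofHom (specToStalk j y) ≫ j.stalkMap y = StructureSheaf.toStalk R y := by
  change ((Scheme.ΓSpecIso (.of R)).inv ≫ (j.appIso ⊤).inv ≫
    X.presheaf.germ (j ''ᵁ ⊤) (j y) (apply_mem_image_top j y)) ≫ j.stalkMap y =
    (Scheme.ΓSpecIso (.of R)).inv ≫ (Spec (.of R)).presheaf.germ ⊤ y trivial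
  rw [Category.assoc, Category.assoc, Scheme.Hom.germ_stalkMap, Scheme.Hom.appIso_inv_app_assoc]
  congr 1
  exact TopCat.Presheaf.germ_res _ _ _ _

lemma isLocalization_specToStalk (y : Spec (.of R)) :
    letI := (specToStalk j y).toAlgebra
    IsLocalization.AtPrime (X.presheaf.stalk (j y)) (pointIdeal y) := by
  let := (specToStalk j y).toAlgebra
  let : Algebra R ((Spec (.of R)).presheaf.stalk y) := StructureSheaf.stalkAlgebra R y
  have : IsLocalization.AtPrime ((Spec (.of R)).presheaf.stalk y) (pointIdeal y) :=
    StructureSheaf.IsLocalization.to_stalk R y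
  let e : X.presheaf.stalk (j y) ≃ₐ[R] (Spec (.of R)).presheaf.stalk y :=
    { (asIso (j.stalkMap y)).commRingCatIsoToRingEquiv with
      commutes' := fun r => congrArg (fun f => f.hom r) (ofHom_specToStalk_stalkMap j y) }
  exact IsLocalization.isLocalization_of_algEquiv (pointIdeal y).primeCompl e.symm

lemma isUnit_specToStalk_iff (y : Spec (.of R)) (r : R) :
    IsUnit (specToStalk j y r) ↔ r ∉ pointIdeal y := by
  let := (specToStalk j y).toAlgebra
  have := isLocalization_specToStalk j y
  exact IsLocalization.AtPrime.isUnit_to_map_iff (X.presheaf.stalk (j y)) (pointIdeal y) r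

lemma exists_mul_specToStalk_eq (y : Spec (.of R)) (s : X.presheaf.stalk (j y)) :
    ∃ a b : R, b ∉ pointIdeal y ∧ s * specToStalk j y b = specToStalk j y a := by
  let := (specToStalk j y).toAlgebra
  have := isLocalization_specToStalk j y
  obtain ⟨⟨a, b⟩, h⟩ := IsLocalization.surj (pointIdeal y).primeCompl s
  exact ⟨a, b, b.2, h⟩

lemma maximalIdeal_eq_map_specToStalk (y : Spec (.of R)) :
    IsLocalRing.maximalIdeal (X.presheaf.stalk (j y)) = (pointIdeal y).map (specToStalk j y) := by
  let := (specToStalk j y).toAlgebra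
  have := isLocalization_specToStalk j y
  exact (IsLocalization.AtPrime.map_eq_maximalIdeal (pointIdeal y) _).symm

section FunctionField

variable [AlgebraicGeometry.IsIntegral X] [IsDomain R]

instance : Nonempty (j ''ᵁ ⊤) :=
  ⟨⟨j (genericPoint _), apply_mem_image_top j _⟩⟩

/-- The inclusion of the coordinate ring of an affine open subscheme in the function field. -/
def specToFunctionField : R →+* X.functionField :=
  ((Scheme.ΓSpecIso (.of R)).inv ≫ (j.appIso ⊤).inv ≫ X.germToFunctionField (j ''ᵁ ⊤)).hom

lemma algebraMap_specToStalk (y : Spec (.of R)) (r : R) :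
    algebraMap (X.presheaf.stalk (j y)) X.functionField (specToStalk j y r) =
      specToFunctionField j r :=
  Scheme.algebraMap_germ_eq_germToFunctionField X (apply_mem_image_top j y) _

lemma specToFunctionField_injective : Function.Injective (specToFunctionField j) :=
  (Scheme.germToFunctionField_injective X (j ''ᵁ ⊤)).comp
    ((Scheme.ΓSpecIso (.of R)).symm ≪≫ (j.appIso ⊤).symm).commRingCatIsoToRingEquiv.injective

lemma specToFunctionField_isFractionRing :
    letI := (specToFunctionField j).toAlgebra
    IsFractionRing R X.functionField := by
  let := (specToFunctionField j).toAlgebra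
  have := functionField_isFractionRing_of_isAffineOpen X (j ''ᵁ ⊤)
    ((isAffineOpen_top _).image_of_isOpenImmersion j)
  exact IsFractionRing.of_ringEquiv_left
    ((Scheme.ΓSpecIso (.of R)).symm ≪≫ (j.appIso ⊤).symm).commRingCatIsoToRingEquiv fun _ => rfl

lemma germToFunctionField_eq_specToFunctionField {U : X.Opens} [Nonempty U]
    (hU : ⊤ ≤ j ⁻¹ᵁ U) {a : Γ(X, U)} {r : R}
    (h : (j.appLE U ⊤ hU).hom a = (Scheme.ΓSpecIso (.of R)).inv.hom r) :
    X.germToFunctionField U a = specToFunctionField j r := by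
  change _ = X.germToFunctionField (j ''ᵁ ⊤)
    ((j.appIso ⊤).inv.hom ((Scheme.ΓSpecIso (.of R)).inv.hom r))
  have hres := congrArg (fun φ => φ.hom a) (Scheme.Hom.appLE_appIso_inv j hU)
  simp only [CommRingCat.hom_comp, RingHom.comp_apply] at hres
  rw [← h, hres]
  exact (TopCat.Presheaf.germ_res_apply _ _ _ _ _).symm

lemma specToFunctionField_comp {S : Type u} [CommRing S] [IsDomain S] (φ : R →+* S)
    [IsOpenImmersion (Spec.map (CommRingCat.ofHom φ))] (r : R) :
    specToFunctionField (Spec.map (CommRingCat.ofHom φ) ≫ j) (φ r) = specToFunctionField j r := by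
  have hU : ⊤ ≤ (Spec.map (CommRingCat.ofHom φ) ≫ j) ⁻¹ᵁ (j ''ᵁ ⊤) :=
    fun y _ => apply_mem_image_top j _
  have hj : ⊤ ≤ j ⁻¹ᵁ (j ''ᵁ ⊤) := fun y _ => apply_mem_image_top j y
  have hcomp : (Scheme.ΓSpecIso (.of R)).inv ≫ (j.appIso ⊤).inv ≫
      (Spec.map (CommRingCat.ofHom φ) ≫ j).appLE (j ''ᵁ ⊤) ⊤ hU =
      CommRingCat.ofHom φ ≫ (Scheme.ΓSpecIso (.of S)).inv := by
    rw [← Scheme.Hom.appLE_comp_appLE _ _ _ ⊤ _ hj le_top, ← Category.assoc (j.appIso ⊤).inv,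
      Scheme.Hom.appIso_inv_appLE, Scheme.ΓSpecIso_inv_naturality]
    simp only [Scheme.Hom.appLE, homOfLE_refl, op_id, CategoryTheory.Functor.map_id,
      TopologicalSpace.Opens.map_top, Category.id_comp, Iso.cancel_iso_inv_left]
    exact Category.comp_id _
  exact (germToFunctionField_eq_specToFunctionField _ hU
    (congrArg (fun f => f.hom r) hcomp)).symm

end FunctionField

section Order

variable [AlgebraicGeometry.IsIntegral X] [IsLocallyNoetherian X]

lemma ord_one (x : X) : X.ord (1 : X.functionField) x = 0 := by
  have hmul := Scheme.ord_mul (x := x) (one_ne_zero (α := X.functionField)) one_ne_zero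
  rwa [mul_one, left_eq_add] at hmul

lemma ord_inv {f : X.functionField} (hf : f ≠ 0) (x : X) : X.ord f⁻¹ x = -X.ord f x := by
  rw [eq_neg_iff_add_eq_zero, ← Scheme.ord_mul (inv_ne_zero hf) hf, inv_mul_cancel₀ hf, ord_one]

lemma exists_algebraMap_stalk_of_ord_nonneg (z : PrimeDivisor X)
    [IsIntegrallyClosed (X.presheaf.stalk z.1)] {f : X.functionField} (h : 0 ≤ X.ord f z.1) :
    ∃ s, algebraMap (X.presheaf.stalk z.1) X.functionField s = f := by
  rcases eq_or_ne f 0 with rfl | hf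
  · exact ⟨0, map_zero _⟩
  have := isDiscreteValuationRing_stalk z
  have : Ring.KrullDimLE 1 (X.presheaf.stalk z.1) := krullDimLE_of_coheight_le z.2.le
  rw [Scheme.le_ord_iff z.2 hf] at h
  have hval : 1 ≤ Ring.ordFrac (X.presheaf.stalk z.1) f := h
  rw [Ring.ordFrac_eq_valuation_inv,
    one_le_inv₀ (zero_lt_iff.2 ((Valuation.ne_zero_iff _).2 hf))] at hval
  obtain ⟨s, n, hs⟩ :=
    IsDedekindDomain.HeightOneSpectrum.exists_primeCompl_mul_eq_of_integer _ f hval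
  obtain ⟨c, hc⟩ : IsUnit (n : X.presheaf.stalk z.1) := not_not.1 n.2
  exact ⟨s * ↑c⁻¹, by
    rw [map_mul, ← hs, mul_assoc, ← map_mul, ← hc, Units.mul_inv, map_one, mul_one]⟩

variable [IsDomain R]

lemma ord_specToFunctionField_of_notMem {y : Spec (.of R)} {r : R} (hr : r ∉ pointIdeal y) :
    X.ord (specToFunctionField j r) (j y) = 0 := by
  by_cases hy : Order.coheight (j y) = 1
  · have : Ring.KrullDimLE 1 (X.presheaf.stalk (j y)) := krullDimLE_of_coheight_le hy.le
    have hunit := (isUnit_specToStalk_iff j y r).2 hr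
    rw [← algebraMap_specToStalk j y, Scheme.ord_eq_iff hy
      ((map_ne_zero_iff _ (IsFractionRing.injective _ _)).2 hunit.ne_zero)]
    exact Ring.ordFrac_of_isUnit hunit
  · exact Scheme.ord_eq_zero_of_coheight_neq_one hy _

lemma ord_specToFunctionField_of_eq_span {y : Spec (.of R)}
    [IsIntegrallyClosed (X.presheaf.stalk (j y))] (hy : Order.coheight (j y) = 1)
    {p : R} (hp : pointIdeal y = Ideal.span {p}) :
    X.ord (specToFunctionField j p) (j y) = 1 := by
  have := isDiscreteValuationRing_stalk ⟨j y, hy⟩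
  have : Ring.KrullDimLE 1 (X.presheaf.stalk (j y)) := krullDimLE_of_coheight_le hy.le
  have hirr : Irreducible (specToStalk j y p) :=
    (IsDiscreteValuationRing.irreducible_iff_uniformizer _).2
      (by rw [maximalIdeal_eq_map_specToStalk, hp, Ideal.map_span, Set.image_singleton])
  rw [← algebraMap_specToStalk j y, Scheme.ord_eq_iff hy
    ((map_ne_zero_iff _ (IsFractionRing.injective _ _)).2 hirr.ne_zero)]
  exact Ring.ordFrac_irreducible hirr

lemma exists_mul_specToFunctionField_eq {y : Spec (.of R)}
    [IsIntegrallyClosed (X.presheaf.stalk (j y))] (hy : Order.coheight (j y) = 1)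
    {f : X.functionField} (h : 0 ≤ X.ord f (j y)) :
    ∃ a b : R, b ∉ pointIdeal y ∧ f * specToFunctionField j b = specToFunctionField j a := by
  obtain ⟨s, rfl⟩ := exists_algebraMap_stalk_of_ord_nonneg ⟨j y, hy⟩ h
  obtain ⟨a, b, hb, h⟩ := exists_mul_specToStalk_eq j y s
  exact ⟨a, b, hb, by rw [← algebraMap_specToStalk j y, ← algebraMap_specToStalk j y, ← map_mul, h]⟩

lemma exists_specToFunctionField_eq [UniqueFactorizationMonoid R] [IsNoetherianRing R]
    [∀ y, IsIntegrallyClosed (X.presheaf.stalk (j y))] {f : X.functionField}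
    (h : ∀ y : Spec (.of R), Order.coheight (j y) = 1 → 0 ≤ X.ord f (j y)) :
    ∃ r, specToFunctionField j r = f := by
  let := (specToFunctionField j).toAlgebra
  have := specToFunctionField_isFractionRing j
  refine exists_algebraMap_eq_of_forall_prime (R := R) fun p hp => ?_
  let y : Spec (.of R) := (⟨Ideal.span {p}, (Ideal.span_singleton_prime hp.ne_zero).2 hp⟩ :
    PrimeSpectrum R)
  have hy : Order.coheight (j y) = 1 := by
    rw [coheight_eq_height_pointIdeal]
    exact Ideal.height_span_singleton_eq_one_of_mem_nonZeroDivisors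
      (mem_nonZeroDivisors_of_ne_zero hp.ne_zero) hp.not_isUnit
  obtain ⟨a, b, hb, hab⟩ := exists_mul_specToFunctionField_eq j hy (h y hy)
  exact ⟨a, b, fun hpb => hb (Ideal.mem_span_singleton.2 hpb), hab⟩

end Order

end AffineCharts

section ToricCharts

variable {k : Type u} [Field k] {N : Type} [AddCommGroup N]

lemma chartMap_coeff {τ σ : PointedCone ℝ (RealSpan N)} (h : τ ≤ σ) (f : ChartRing k σ)
    (u : dualMonoid σ) :
    (chartMap k h f).coeff (AddSubmonoid.inclusion (dualMonoid_anti h) u) = f.coeff u := by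
  classical
  induction f using AddMonoidAlgebra.induction_linear with
  | zero => simp
  | add f g hf hg => simp [hf, hg]
  | single w c =>
    rw [chartMap_single, AddMonoidAlgebra.coeff_single, AddMonoidAlgebra.coeff_single,
      Finsupp.single_apply, Finsupp.single_apply]
    simp only [(AddSubmonoid.inclusion_injective (dualMonoid_anti h)).eq_iff]

lemma exists_chartMap_eq {τ σ : PointedCone ℝ (RealSpan N)} (h : τ ≤ σ) (f : ChartRing k τ)
    (hf : ∀ u, f.coeff u ≠ 0 → u.1 ∈ dualMonoid σ) : ∃ g, chartMap k h g = f := by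
  rw [← AddMonoidAlgebra.sum_coeff_single f]
  refine Subalgebra.sum_mem (chartMap k h).range fun u hu => ?_
  exact ⟨AddMonoidAlgebra.single ⟨u, hf u (Finsupp.mem_support_iff.1 hu)⟩ (f.coeff u),
    chartMap_single ..⟩

lemma comap_rayIdeal_le {v : N} {σ : PointedCone ℝ (RealSpan N)} (h : rayCone v ≤ σ)
    {P : Ideal (ChartRing k σ)}
    (hP : ∀ u : dualMonoid σ, 0 < u.1 v → AddMonoidAlgebra.single u (1 : k) ∈ P) :
    (rayIdeal k v).comap (chartMap k h) ≤ P := by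
  intro f hf
  rw [Ideal.mem_comap, mem_rayIdeal_iff] at hf
  rw [← AddMonoidAlgebra.sum_coeff_single f]
  refine Ideal.sum_mem _ fun u hu => ?_
  have hpos : 0 < u.1 v := by
    refine (mem_dualMonoid_rayCone.1 (dualMonoid_anti h u.2)).lt_of_ne fun h0 => ?_
    refine Finsupp.mem_support_iff.1 hu ?_
    rw [← chartMap_coeff h]
    exact hf _ h0.symm
  have hsingle : AddMonoidAlgebra.single u (f.coeff u) =
      f.coeff u • AddMonoidAlgebra.single u (1 : k) := by
    rw [AddMonoidAlgebra.smul_single', mul_one]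
  change AddMonoidAlgebra.single u (f.coeff u) ∈ P
  rw [hsingle]
  exact Submodule.smul_of_tower_mem P _ (hP u hpos)

variable [Module.Finite ℤ N] {Δ : Fan N}

variable (k Δ) in
/-- The torus `T = U_0`, as a subset of the toric variety. -/
def torus : Set (toricVariety k Δ) := Set.range (chartι k Δ.zeroCone)

lemma exists_single_mem_pointIdeal {σ : Δ.Cone} {y : Spec (.of (ChartRing k σ.1))}
    (hy : chartι k σ y ∉ torus k Δ) :
    ∃ w : dualMonoid σ.1, AddMonoidAlgebra.single w (1 : k) ∈ pointIdeal y := by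
  obtain ⟨-, w, hw, -, hrange⟩ := chartFunctor_map k Δ (homOfLE (Δ.zeroCone_le σ))
  refine ⟨⟨w, hw⟩, ?_⟩
  by_contra hmem
  obtain ⟨x, rfl⟩ : y ∈ Set.range ((chartFunctor k Δ).map (homOfLE (Δ.zeroCone_le σ))) := by
    rw [hrange]
    exact hmem
  refine hy ⟨x, ?_⟩
  rw [← chartFunctor_map_chartι k (homOfLE (Δ.zeroCone_le σ))]
  rfl

variable [Module.Free ℤ N]

lemma Fan.exists_nsmul_sub_mem_dualMonoid {σ : Δ.Cone} {U : DualLattice N}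
    (hU : ∀ ρ : Δ.Ray, ρ.cone ≤ σ → 0 < U ρ.gen) (w : DualLattice N) :
    ∃ n : ℕ, n • U - w ∈ dualMonoid σ.1 := by
  refine ⟨∑ ρ : Δ.Ray, (w ρ.gen).natAbs, ?_⟩
  rw [Δ.cone_eq_hull_rayGenerators σ, mem_dualMonoid_hull]
  rintro _ ⟨ρ, rfl, hρ⟩
  have hw : w ρ.gen ≤ (∑ ρ : Δ.Ray, (w ρ.gen).natAbs : ℕ) :=
    Int.le_natAbs.trans (Int.ofNat_le.2 (Finset.single_le_sum
      (f := fun ρ : Δ.Ray => (w ρ.gen).natAbs) (fun _ _ => Nat.zero_le _) (Finset.mem_univ ρ)))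
  rw [LinearMap.sub_apply, LinearMap.smul_apply, nsmul_eq_mul, sub_nonneg]
  exact hw.trans (le_mul_of_one_le_right (Nat.cast_nonneg _) (hU ρ hρ))

/- Otherwise the sum of one monomial `x^{u_ρ} ∉ P` for each ray `ρ` of `σ` is again outside `P`, but
some power of it is divisible by `x^w`, because `∑ u_ρ` is positive on every ray of `σ`. -/
lemma exists_ray_forall_single_mem {σ : Δ.Cone} {P : Ideal (ChartRing k σ.1)} (hP : P.IsPrime)
    {w : dualMonoid σ.1} (hw : AddMonoidAlgebra.single w (1 : k) ∈ P) :
    ∃ ρ : Δ.Ray, ρ.cone ≤ σ ∧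
      ∀ u : dualMonoid σ.1, 0 < u.1 ρ.gen → AddMonoidAlgebra.single u (1 : k) ∈ P := by
  by_contra! hne
  have := Fintype.ofFinite {ρ : Δ.Ray // ρ.cone ≤ σ}
  choose u hpos hnotMem using fun ρ : {ρ : Δ.Ray // ρ.cone ≤ σ} => hne ρ.1 ρ.2
  have hU : ∀ ρ : Δ.Ray, ρ.cone ≤ σ → 0 < (∑ ρ, u ρ : dualMonoid σ.1).1 ρ.gen := by
    intro ρ hρ
    rw [AddSubmonoid.coe_finsetSum, LinearMap.sum_apply]
    exact Finset.sum_pos' (fun ρ' _ => mem_dualMonoid_rayCone.1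
      (dualMonoid_anti (show rayCone ρ.gen ≤ σ.1 from hρ) (u ρ').2))
      ⟨⟨ρ, hρ⟩, Finset.mem_univ _, hpos ⟨ρ, hρ⟩⟩
  have hprod : AddMonoidAlgebra.single (∑ ρ, u ρ) (1 : k) ∉ P := by
    have hprod_single : AddMonoidAlgebra.single (∑ ρ, u ρ) (1 : k) =
        ∏ ρ, AddMonoidAlgebra.single (u ρ) 1 := by
      rw [AddMonoidAlgebra.prod_single, Finset.prod_const_one]
    rw [hprod_single, hP.prod_mem_iff]
    rintro ⟨ρ, -, h⟩
    exact hnotMem ρ h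
  obtain ⟨n, hn⟩ := Fan.exists_nsmul_sub_mem_dualMonoid hU w.1
  have hpow : AddMonoidAlgebra.single (∑ ρ, u ρ) (1 : k) ^ n =
      AddMonoidAlgebra.single ⟨_, hn⟩ 1 * AddMonoidAlgebra.single w 1 := by
    rw [AddMonoidAlgebra.single_pow, AddMonoidAlgebra.single_mul_single, one_pow, one_mul]
    congr 1
    exact Subtype.ext (sub_add_cancel _ _).symm
  exact hprod (hP.mem_of_pow_mem n (hpow ▸ P.mul_mem_left _ hw))

lemma exists_chartι_eq_rayDivisor (ρ : Δ.Ray) {σ : Δ.Cone} (h : ρ.cone ≤ σ) :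
    ∃ y, chartι k σ y = (rayDivisor k ρ).1 ∧
      pointIdeal y = (rayIdeal k ρ.gen).comap (chartMap k (show rayCone ρ.gen ≤ σ.1 from h)) := by
  let g : Spec (.of (ChartRing k (rayCone ρ.gen))) ⟶ Spec (.of (ChartRing k σ.1)) :=
    (chartFunctor k Δ).map (homOfLE h)
  have hg : g ≫ chartι k σ = chartι k ρ.cone := chartFunctor_map_chartι k (homOfLE h)
  exact ⟨g (rayPoint ρ.gen), congrArg (fun φ => φ (rayPoint ρ.gen)) hg, rfl⟩

theorem exists_rayDivisor_eq {Z : PrimeDivisor (toricVariety k Δ)} (hZ : Z.1 ∉ torus k Δ) :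
    ∃ ρ : Δ.Ray, rayDivisor k ρ = Z := by
  obtain ⟨σ, y, hy⟩ := exists_chartι_eq k Z.1
  obtain ⟨w, hw⟩ := exists_single_mem_pointIdeal (hy ▸ hZ)
  obtain ⟨ρ, hρσ, hρ⟩ := exists_ray_forall_single_mem (pointIdeal_isPrime y) hw
  obtain ⟨x, hx, hxρ⟩ := exists_chartι_eq_rayDivisor (k := k) ρ hρσ
  have hle : pointIdeal x ≤ pointIdeal y := hxρ ▸ comap_rayIdeal_le _ hρ
  have hxheight : (pointIdeal x).height = 1 := by
    rw [← coheight_eq_height_pointIdeal (chartι k σ), hx, (rayDivisor k ρ).2]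
  have hyheight : (pointIdeal y).height = 1 := by
    rw [← coheight_eq_height_pointIdeal (chartι k σ), hy, Z.2]
  have : (pointIdeal x).FiniteHeight := ⟨Or.inr (hxheight ▸ ENat.one_ne_top)⟩
  have hxy := pointIdeal_injective (Ideal.eq_of_le_of_height_le _ hle (by rw [hxheight, hyheight]))
  exact ⟨ρ, Subtype.ext (by rw [← hx, hxy, hy])⟩

end ToricCharts

section Characters

variable {k : Type u} [Field k] {N : Type} [AddCommGroup N] [Module.Finite ℤ N] [Module.Free ℤ N]
  {Δ : Fan N}

lemma specToFunctionField_chartMap {τ σ : Δ.Cone} (h : τ ≤ σ) (f : ChartRing k σ.1) :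
    specToFunctionField (chartι k τ) (chartMap k h f) = specToFunctionField (chartι k σ) f := by
  let φ : ChartRing k σ.1 →+* ChartRing k τ.1 := (chartMap k (show τ.1 ≤ σ.1 from h)).toRingHom
  have : IsOpenImmersion (Spec.map (CommRingCat.ofHom φ)) := (chartFunctor_map k Δ (homOfLE h)).1
  have hφ : Spec.map (CommRingCat.ofHom φ) ≫ chartι k σ = chartι k τ :=
    chartFunctor_map_chartι k (homOfLE h)
  rw [← specToFunctionField_comp (chartι k σ) φ]
  simp only [hφ]
  rfl

lemma torusToFunctionField_injective : Function.Injective (torusToFunctionField k Δ) :=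
  specToFunctionField_injective (chartι k Δ.zeroCone)

lemma torusToFunctionField_algebraMap (c : k) :
    torusToFunctionField k Δ (algebraMap k _ c) = algebraMap k _ c := by
  have hstructure : chartι k Δ.zeroCone ≫ structureMorphism k Δ =
      Spec.map (CommRingCat.ofHom (algebraMap k (ChartRing k Δ.zeroCone.1))) :=
    colimit.ι_desc _ _
  have hconst : (Scheme.ΓSpecIso (.of k)).inv ≫ (structureMorphism k Δ).appTop ≫
      (chartι k Δ.zeroCone).appTop =
      CommRingCat.ofHom (algebraMap k (ChartRing k Δ.zeroCone.1)) ≫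
        (Scheme.ΓSpecIso (.of (ChartRing k Δ.zeroCone.1))).inv := by
    rw [Scheme.ΓSpecIso_inv_naturality, ← hstructure, Scheme.Hom.comp_appTop]
  have happLE : (chartι k Δ.zeroCone).appLE ⊤ ⊤ le_top = (chartι k Δ.zeroCone).appTop := by
    simp only [Scheme.Hom.appLE, TopologicalSpace.Opens.map_top, homOfLE_refl, op_id,
      CategoryTheory.Functor.map_id]
    exact Category.comp_id _
  refine (germToFunctionField_eq_specToFunctionField (chartι k Δ.zeroCone) (U := ⊤) le_top ?_).symm
  rw [happLE]
  exact congrArg (fun f => f.hom c) hconst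

variable (k Δ) in
/-- The inclusion `k[M] → k(X)` as a homomorphism of `k`-algebras. -/
def torusToFunctionFieldₐ : ChartRing k Δ.zeroCone.1 →ₐ[k] (toricVariety k Δ).functionField where
  __ := torusToFunctionField k Δ
  commutes' := torusToFunctionField_algebraMap

lemma character_eq_specToFunctionField {σ : Δ.Cone} (u : dualMonoid σ.1) :
    character k Δ u = specToFunctionField (chartι k σ) (AddMonoidAlgebra.single u 1) := by
  rw [← specToFunctionField_chartMap (Δ.zeroCone_le σ), chartMap_single]
  rfl

lemma character_add (u w : DualLattice N) :
    character k Δ (u + w) = character k Δ u * character k Δ w := by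
  rw [character, character, character, ← map_mul, AddMonoidAlgebra.single_mul_single, one_mul]
  rfl

lemma character_ne_zero (u : DualLattice N) : character k Δ u ≠ 0 :=
  ((isUnit_torusMonomial u).map (torusToFunctionField k Δ)).ne_zero

/-- The order of vanishing of the characters along a prime divisor, a homomorphism `M → ℤ`. -/
def characterOrd (Z : PrimeDivisor (toricVariety k Δ)) : DualLattice N →+ ℤ :=
  .mk' (fun u => (toricVariety k Δ).ord (character k Δ u) Z.1) fun u w => by
    rw [character_add, Scheme.ord_mul (character_ne_zero u) (character_ne_zero w)]

lemma ord_character_of_mem_torus {x : toricVariety k Δ} (hx : x ∈ torus k Δ) (u : DualLattice N) :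
    (toricVariety k Δ).ord (character k Δ u) x = 0 := by
  obtain ⟨y, rfl⟩ := hx
  exact ord_specToFunctionField_of_notMem (chartι k Δ.zeroCone) fun h =>
    (pointIdeal_isPrime y).ne_top (Ideal.eq_top_of_isUnit_mem _ h (isUnit_torusMonomial u))

theorem ord_character_rayDivisor (ρ : Δ.Ray) (u : DualLattice N) :
    (toricVariety k Δ).ord (character k Δ u) (rayDivisor k ρ).1 = u ρ.gen := by
  have horth : ∀ w : DualLattice N, w ρ.gen = 0 → characterOrd (rayDivisor k ρ) w = 0 := by
    intro w hw
    have hmem : w ∈ dualMonoid ρ.cone.1 := mem_dualMonoid_rayCone.2 hw.ge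
    change (toricVariety k Δ).ord (character k Δ w) _ = 0
    rw [character_eq_specToFunctionField (σ := ρ.cone) ⟨w, hmem⟩]
    refine ord_specToFunctionField_of_notMem (chartι k ρ.cone) fun h => ?_
    exact one_ne_zero (α := k)
      (Finsupp.single_eq_same.symm.trans (mem_rayIdeal_iff.1 h ⟨w, hmem⟩ hw))
  obtain ⟨m, hm⟩ := ρ.isPrimitive.exists_eq_one
  have hord : characterOrd (rayDivisor k ρ) m = 1 := by
    have hmem : m ∈ dualMonoid ρ.cone.1 := mem_dualMonoid_rayCone.2 (hm ▸ zero_le_one)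
    change (toricVariety k Δ).ord (character k Δ m) _ = 1
    rw [character_eq_specToFunctionField (σ := ρ.cone) ⟨m, hmem⟩]
    exact ord_specToFunctionField_of_eq_span (chartι k ρ.cone) (rayDivisor k ρ).2
      (rayIdeal_eq_span (m := ⟨m, hmem⟩) hm)
  have hsplit := horth (u - u ρ.gen • m) (by simp [hm])
  rw [map_sub, map_zsmul, hord, smul_eq_mul, mul_one, sub_eq_zero] at hsplit
  exact hsplit

lemma rayDivisor_injective : Function.Injective (rayDivisor k (Δ := Δ)) := fun ρ ρ' h => by
  refine Fan.Ray.ext ((Module.finBasis ℤ N).ext_elem fun i => ?_)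
  change (Module.finBasis ℤ N).coord i ρ.gen = (Module.finBasis ℤ N).coord i ρ'.gen
  rw [← ord_character_rayDivisor (k := k), h, ord_character_rayDivisor]

lemma rayDivisor_notMem_torus (ρ : Δ.Ray) : (rayDivisor k ρ).1 ∉ torus k Δ := fun h => by
  obtain ⟨m, hm⟩ := ρ.isPrimitive.exists_eq_one
  have hord := ord_character_of_mem_torus h m
  rw [ord_character_rayDivisor, hm] at hord
  exact one_ne_zero hord

lemma exists_torusToFunctionField_eq {f : (toricVariety k Δ).functionField}
    (h : ∀ Z : PrimeDivisor (toricVariety k Δ), Z.1 ∈ torus k Δ →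
      0 ≤ (toricVariety k Δ).ord f Z.1) :
    ∃ r, torusToFunctionField k Δ r = f := by
  have : IsNoetherianRing (ChartRing k Δ.zeroCone.1) :=
    chartRing_isNoetherian (Δ.rational _ Δ.zeroCone.2)
  have : UniqueFactorizationMonoid (ChartRing k Δ.zeroCone.1) :=
    inferInstanceAs (UniqueFactorizationMonoid (ChartRing k ⊥))
  exact exists_specToFunctionField_eq (chartι k Δ.zeroCone) fun y hy => h ⟨_, hy⟩ ⟨y, rfl⟩

lemma ord_torusToFunctionField_of_isMin (ρ : Δ.Ray) {f : ChartRing k Δ.zeroCone.1}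
    {u₀ : dualMonoid Δ.zeroCone.1} (hu₀ : f.coeff u₀ ≠ 0)
    (hmin : ∀ u, f.coeff u ≠ 0 → u₀.1 ρ.gen ≤ u.1 ρ.gen) :
    (toricVariety k Δ).ord (torusToFunctionField k Δ f) (rayDivisor k ρ).1 = u₀.1 ρ.gen := by
  let h : ChartRing k Δ.zeroCone.1 := AddMonoidAlgebra.single ⟨-u₀.1, mem_dualMonoid_bot _⟩ 1 * f
  have hf : AddMonoidAlgebra.single u₀ 1 * h = f := by
    rw [← mul_assoc, AddMonoidAlgebra.single_mul_single, one_mul]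
    convert one_mul f
    exact congrArg (AddMonoidAlgebra.single · 1) (Subtype.ext (add_neg_cancel u₀.1))
  have hcoeff (w) : h.coeff w = f.coeff (u₀ + w) := by
    conv_rhs => rw [← hf]
    rw [AddMonoidAlgebra.coeff_single_mul_add, one_mul]
  have hle : Δ.zeroCone.1 ≤ ρ.cone.1 := Δ.zeroCone_le ρ.cone
  obtain ⟨g, hg⟩ := exists_chartMap_eq hle h fun w hw =>
    mem_dualMonoid_rayCone.2 <| le_add_iff_nonneg_right _ |>.1 <| hmin (u₀ + w) (hcoeff w ▸ hw)
  have hg0 : g ∉ rayIdeal k ρ.gen := fun hmem => by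
    have hzero : (chartMap k hle g).coeff 0 = 0 :=
      (chartMap_coeff hle g 0).trans (mem_rayIdeal_iff.1 hmem 0 rfl)
    rw [hg, hcoeff, add_zero] at hzero
    exact hu₀ hzero
  have hfactor : torusToFunctionField k Δ f =
      character k Δ u₀ * specToFunctionField (chartι k ρ.cone) g := by
    rw [← specToFunctionField_chartMap (Δ.zeroCone_le ρ.cone), hg, ← hf, map_mul]
    rfl
  have hgne : specToFunctionField (chartι k ρ.cone) g ≠ 0 := by
    rw [Ne, map_eq_zero_iff _ (specToFunctionField_injective _)]
    exact fun h0 => hg0 (h0 ▸ Ideal.zero_mem _)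
  rw [hfactor, Scheme.ord_mul (character_ne_zero _) hgne, ord_character_rayDivisor, add_eq_left]
  exact ord_specToFunctionField_of_notMem (chartι k ρ.cone) hg0

lemma ord_torusToFunctionField_le (ρ : Δ.Ray) {f : ChartRing k Δ.zeroCone.1}
    {u : dualMonoid Δ.zeroCone.1} (hu : f.coeff u ≠ 0) :
    (toricVariety k Δ).ord (torusToFunctionField k Δ f) (rayDivisor k ρ).1 ≤ u.1 ρ.gen := by
  obtain ⟨u₀, hu₀, hmin⟩ := f.coeff.support.exists_min_image (fun u => u.1 ρ.gen)
    ⟨u, Finsupp.mem_support_iff.2 hu⟩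
  rw [ord_torusToFunctionField_of_isMin ρ (Finsupp.mem_support_iff.1 hu₀) fun w hw =>
    hmin w (Finsupp.mem_support_iff.2 hw)]
  exact hmin u (Finsupp.mem_support_iff.2 hu)

end Characters

section InvariantDivisors

variable {k : Type u} [Field k] {N : Type} [AddCommGroup N] [Module.Finite ℤ N] {Δ : Fan N}

lemma torusAction_chartι (t : TorusPoint k N) (σ : Δ.Cone) (y : Spec (.of (ChartRing k σ.1))) :
    torusAction t (chartι k σ y) =
      chartι k σ (Spec.map (CommRingCat.ofHom (chartAction t σ.1).toRingHom) y) := by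
  have h : chartι k σ ≫ torusAction t =
      Spec.map (CommRingCat.ofHom (chartAction t σ.1).toRingHom) ≫ chartι k σ := ι_colimMap _ _
  exact congrArg (fun φ => φ y) h

lemma coheight_torusAction (t : TorusPoint k N) (x : toricVariety k Δ) :
    Order.coheight (torusAction t x) = Order.coheight x := by
  obtain ⟨σ, y, rfl⟩ := exists_chartι_eq k x
  rw [torusAction_chartι, coheight_eq_height_pointIdeal, coheight_eq_height_pointIdeal]
  exact RingEquiv.height_comap (chartActionEquiv t σ.1).toRingEquiv (pointIdeal y)

lemma infinite_orbit [Infinite k] (Z : PrimeDivisor (toricVariety k Δ)) (hZ : Z.1 ∈ torus k Δ) :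
    (Set.range fun t : TorusPoint k N => torusAction t Z.1).Infinite := by
  obtain ⟨y, hy⟩ := hZ
  have hheight : (pointIdeal y).height = 1 := by
    rw [← coheight_eq_height_pointIdeal (chartι k Δ.zeroCone), hy, Z.2]
  have hbot : pointIdeal y ≠ ⊥ := fun h => by
    rw [h, Ideal.height_bot] at hheight
    exact zero_ne_one hheight
  obtain ⟨v, hv⟩ := exists_infinite_translates hbot (pointIdeal_isPrime y).ne_top
  refine fun hfin => hv (((hfin.preimage
    (chartι k Δ.zeroCone).isOpenEmbedding.injective.injOn).image pointIdeal).subset ?_)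
  rintro _ ⟨c, rfl⟩
  exact ⟨Spec.map (CommRingCat.ofHom (chartAction (oneParameter v c) Δ.zeroCone.1).toRingHom) y,
    ⟨oneParameter v c, (congrArg _ hy.symm).trans (torusAction_chartι ..)⟩, rfl⟩

/-- A divisor is supported on the boundary `X ∖ T` if no prime divisor that meets the torus occurs
in it. Over a finite field, invariance under the finite group `T(k)` is a weaker condition. -/
def IsSupportedOnBoundary (D : WeilDivisor (toricVariety k Δ)) : Prop :=
  ∀ Z : PrimeDivisor (toricVariety k Δ), Z.1 ∈ torus k Δ → D Z = 0

lemma IsTorusInvariant.isSupportedOnBoundary [Infinite k] {D : WeilDivisor (toricVariety k Δ)}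
    (hD : IsTorusInvariant D) : IsSupportedOnBoundary D := by
  intro Z hZ
  by_contra hne
  refine infinite_orbit Z hZ ((D.support.finite_toSet.image Subtype.val).subset ?_)
  rintro _ ⟨t, rfl⟩
  refine ⟨⟨torusAction t Z.1, (coheight_torusAction t Z.1).trans Z.2⟩, ?_, rfl⟩
  rw [Finset.mem_coe, Finsupp.mem_support_iff, hD t Z _ rfl]
  exact hne

end InvariantDivisors

section ClassGroup

variable {k : Type u} [Field k] {N : Type} [AddCommGroup N] [Module.Finite ℤ N] [Module.Free ℤ N]
  {Δ : Fan N} {D E : WeilDivisor (toricVariety k Δ)}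

lemma forall_primeDivisor_iff {P : PrimeDivisor (toricVariety k Δ) → Prop}
    (hP : ∀ Z, Z.1 ∈ torus k Δ → P Z) : (∀ Z, P Z) ↔ ∀ ρ : Δ.Ray, P (rayDivisor k ρ) := by
  refine ⟨fun h ρ => h _, fun h Z => ?_⟩
  by_cases hZ : Z.1 ∈ torus k Δ
  · exact hP Z hZ
  · obtain ⟨ρ, rfl⟩ := exists_rayDivisor_eq hZ
    exact h ρ

theorem exists_forall_ord_eq_ord_character {f : (toricVariety k Δ).functionField} (hf : f ≠ 0)
    (h : ∀ Z : PrimeDivisor (toricVariety k Δ), Z.1 ∈ torus k Δ →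
      (toricVariety k Δ).ord f Z.1 = 0) :
    ∃ u, ∀ Z : PrimeDivisor (toricVariety k Δ),
      (toricVariety k Δ).ord f Z.1 = (toricVariety k Δ).ord (character k Δ u) Z.1 := by
  obtain ⟨r, hr⟩ := exists_torusToFunctionField_eq (f := f) fun Z hZ => (h Z hZ).ge
  obtain ⟨s, hs⟩ := exists_torusToFunctionField_eq (f := f⁻¹) fun Z hZ => by
    rw [ord_inv hf, h Z hZ, neg_zero]
  have hunit : IsUnit r := .of_mul_eq_one s <| torusToFunctionField_injective <| by
    rw [map_mul, hr, hs, mul_inv_cancel₀ hf, map_one]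
  obtain ⟨u, c, hc, rfl⟩ := exists_eq_single_of_isUnit hunit
  have hcoeff {w} (hw : (AddMonoidAlgebra.single u c).coeff w ≠ 0) : u = w := by
    by_contra hne
    exact hw (Finsupp.single_eq_of_ne (Ne.symm hne))
  refine ⟨u, (forall_primeDivisor_iff fun Z hZ => ?_).2 fun ρ => ?_⟩
  · rw [h Z hZ, ord_character_of_mem_torus hZ]
  · rw [← hr, ord_character_rayDivisor]
    refine ord_torusToFunctionField_of_isMin ρ ?_ fun w hw => (congrArg (·.1 ρ.gen) (hcoeff hw)).le
    rwa [AddMonoidAlgebra.coeff_single, Finsupp.single_eq_same]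

theorem mk_eq_mk_iff (hD : IsSupportedOnBoundary D) (hE : IsSupportedOnBoundary E) :
    (QuotientAddGroup.mk D : DivisorClassGroup (toricVariety k Δ)) = QuotientAddGroup.mk E ↔
      ∃ u : DualLattice N, ∀ ρ : Δ.Ray, E (rayDivisor k ρ) = u ρ.gen + D (rayDivisor k ρ) := by
  have hprincipal : ∀ Z (f : (toricVariety k Δ).functionField),
      (-D + E) Z = (toricVariety k Δ).ord f Z.1 ↔ E Z = (toricVariety k Δ).ord f Z.1 + D Z := by
    intro Z f
    rw [Finsupp.add_apply, Finsupp.neg_apply, neg_add_eq_iff_eq_add, add_comm]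
  rw [QuotientAddGroup.eq]
  constructor
  · rintro ⟨f, hf, hdiv⟩
    obtain ⟨u, hu⟩ := exists_forall_ord_eq_ord_character hf fun Z hZ => by
      rw [← hdiv, Finsupp.add_apply, Finsupp.neg_apply, hD Z hZ, hE Z hZ, neg_zero, add_zero]
    refine ⟨u, fun ρ => ?_⟩
    rw [← ord_character_rayDivisor (k := k), ← hu]
    exact (hprincipal _ f).1 (hdiv _)
  · rintro ⟨u, hu⟩
    refine ⟨character k Δ u, character_ne_zero u, (forall_primeDivisor_iff fun Z hZ => ?_).2
      fun ρ => ?_⟩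
    · rw [hprincipal, hD Z hZ, hE Z hZ, ord_character_of_mem_torus hZ, add_zero]
    · rw [hprincipal, ord_character_rayDivisor, hu]

end ClassGroup

section CoxRing

variable {k : Type u} [Field k] {N : Type} [AddCommGroup N] [Module.Finite ℤ N] [Module.Free ℤ N]
  {Δ : Fan N}

variable (k) in
/-- The effective boundary divisor `∑ d_i Y(v_i)` of the monomial with exponents `d_i`. -/
def rayDivisorSum (d : Δ.Ray →₀ ℕ) : WeilDivisor (toricVariety k Δ) :=
  (d.mapRange (Nat.cast : ℕ → ℤ) Nat.cast_zero).mapDomain (rayDivisor k)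

lemma rayDivisorSum_rayDivisor (d : Δ.Ray →₀ ℕ) (ρ : Δ.Ray) :
    rayDivisorSum k d (rayDivisor k ρ) = d ρ := by
  rw [rayDivisorSum, Finsupp.mapDomain_apply rayDivisor_injective, Finsupp.mapRange_apply]

lemma isSupportedOnBoundary_rayDivisorSum (d : Δ.Ray →₀ ℕ) :
    IsSupportedOnBoundary (rayDivisorSum k d) := fun _ hZ =>
  Finsupp.mapDomain_of_notMem_range _ _ fun ⟨ρ, hρ⟩ => rayDivisor_notMem_torus ρ (hρ ▸ hZ)

lemma weight_coxDegree (d : Δ.Ray →₀ ℕ) :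
    Finsupp.weight (coxDegree k) d =
      (QuotientAddGroup.mk (rayDivisorSum k d) : DivisorClassGroup (toricVariety k Δ)) := by
  rw [Finsupp.weight_apply, rayDivisorSum, Finsupp.mapDomain, ← QuotientAddGroup.mk'_apply,
    map_finsuppSum, Finsupp.sum_mapRange_index fun ρ => by simp]
  refine Finsupp.sum_congr fun ρ _ => ?_
  rw [coxDegree, ← QuotientAddGroup.mk'_apply, ← map_nsmul, Finsupp.smul_single, nsmul_one]

/-- The lattice points `u ∈ M` of the polyhedron `P_D = {u | ⟨u, v_i⟩ ≥ -a_i}` of a divisor `D` with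
coefficients `a_i` along the divisors `Y(v_i)`. -/
def polyhedronPoints (D : WeilDivisor (toricVariety k Δ)) : Set (DualLattice N) :=
  {u | ∀ ρ : Δ.Ray, 0 ≤ u ρ.gen + D (rayDivisor k ρ)}

/-- The exponents `⟨u, v_i⟩ + a_i` of the monomial corresponding to the character `x^u`. The
truncation has no effect for `u ∈ P_D`. -/
def coxExponent (D : WeilDivisor (toricVariety k Δ)) (u : DualLattice N) : Δ.Ray →₀ ℕ :=
  Finsupp.equivFunOnFinite.symm fun ρ => (u ρ.gen + D (rayDivisor k ρ)).toNat

variable {D : WeilDivisor (toricVariety k Δ)}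

lemma coxExponent_apply {u : DualLattice N} (hu : u ∈ polyhedronPoints D) (ρ : Δ.Ray) :
    (coxExponent D u ρ : ℤ) = u ρ.gen + D (rayDivisor k ρ) :=
  Int.toNat_of_nonneg (hu ρ)

lemma coxExponent_injOn (hΔ : Δ.IsNondegenerate) :
    Set.InjOn (coxExponent D) (polyhedronPoints D) := by
  refine fun u hu w hw h => hΔ.eq_of_rays fun ρ => ?_
  rw [← add_left_inj (D (rayDivisor k ρ)), ← coxExponent_apply hu, h, coxExponent_apply hw]

lemma monomial_coxExponent (u : DualLattice N) :
    (MvPolynomial.monomial (coxExponent D u) 1 : CoxRing k Δ) =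
      ∏ ρ : Δ.Ray, MvPolynomial.X ρ ^ (u ρ.gen + D (rayDivisor k ρ)).toNat := by
  rw [MvPolynomial.monomial_eq, map_one, one_mul, Finsupp.prod_fintype _ _ (fun _ => pow_zero _)]
  rfl

theorem weight_coxDegree_eq_mk_iff (hD : IsSupportedOnBoundary D) (d : Δ.Ray →₀ ℕ) :
    Finsupp.weight (coxDegree k) d =
      (QuotientAddGroup.mk D : DivisorClassGroup (toricVariety k Δ)) ↔
      d ∈ coxExponent D '' polyhedronPoints D := by
  rw [weight_coxDegree, eq_comm, mk_eq_mk_iff hD (isSupportedOnBoundary_rayDivisorSum d)]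
  simp only [rayDivisorSum_rayDivisor]
  constructor
  · rintro ⟨u, hu⟩
    have hmem : u ∈ polyhedronPoints D := fun ρ => hu ρ ▸ Int.natCast_nonneg _
    refine ⟨u, hmem, Finsupp.ext fun ρ => ?_⟩
    exact_mod_cast (coxExponent_apply hmem ρ).trans (hu ρ).symm
  · rintro ⟨u, hu, rfl⟩
    exact ⟨u, coxExponent_apply hu⟩

lemma span_monomial_eq_coxGradedPiece (hD : IsSupportedOnBoundary D) :
    Submodule.span k (Set.range fun u : polyhedronPoints D =>
      (MvPolynomial.monomial (coxExponent D u) 1 : CoxRing k Δ)) =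
      coxGradedPiece (QuotientAddGroup.mk D : DivisorClassGroup (toricVariety k Δ)) := by
  have hdegree : {d | Finsupp.weight (coxDegree k) d =
      (QuotientAddGroup.mk D : DivisorClassGroup (toricVariety k Δ))} =
      coxExponent D '' polyhedronPoints D := Set.ext (weight_coxDegree_eq_mk_iff hD)
  rw [coxGradedPiece, MvPolynomial.weightedHomogeneousSubmodule_eq_finsupp_supported, hdegree,
    AddMonoidAlgebra.supported_eq_span_single, Set.image_image, Set.image_eq_range]
  rfl

lemma linearIndependent_monomial_coxExponent (hΔ : Δ.IsNondegenerate) :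
    LinearIndependent k (fun u : polyhedronPoints D =>
      (MvPolynomial.monomial (coxExponent D u) 1 : CoxRing k Δ)) := by
  have h := (MvPolynomial.basisMonomials Δ.Ray k).linearIndependent.comp _
    (coxExponent_injOn (D := D) hΔ).injective
  rwa [MvPolynomial.coe_basisMonomials] at h

/-- The basis of the graded piece of degree `[D]` of the Cox ring given by its monomials. -/
def coxGradedPieceBasis (hΔ : Δ.IsNondegenerate) (hD : IsSupportedOnBoundary D) :
    Module.Basis (polyhedronPoints D) k
      (coxGradedPiece (QuotientAddGroup.mk D : DivisorClassGroup (toricVariety k Δ))) :=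
  (Module.Basis.span (linearIndependent_monomial_coxExponent hΔ)).map
    (LinearEquiv.ofEq _ _ (span_monomial_eq_coxGradedPiece hD))

lemma coxGradedPieceBasis_apply (hΔ : Δ.IsNondegenerate) (hD : IsSupportedOnBoundary D)
    (u : polyhedronPoints D) : (coxGradedPieceBasis hΔ hD u : CoxRing k Δ) =
      ∏ ρ : Δ.Ray, MvPolynomial.X ρ ^ (u.1 ρ.gen + D (rayDivisor k ρ)).toNat := by
  rw [coxGradedPieceBasis, Module.Basis.map_apply, LinearEquiv.coe_ofEq_apply,
    Module.Basis.span_apply]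
  exact monomial_coxExponent _

end CoxRing

section GlobalSections

variable {k : Type u} [Field k] {N : Type} [AddCommGroup N] [Module.Finite ℤ N] [Module.Free ℤ N]
  {Δ : Fan N}

lemma linearIndependent_character : LinearIndependent k (character k Δ) := by
  have hsingle : LinearIndependent k fun u : dualMonoid Δ.zeroCone.1 =>
      (AddMonoidAlgebra.single u 1 : ChartRing k Δ.zeroCone.1) :=
    .of_comp (AddMonoidAlgebra.coeffLinearEquiv k).toLinearMap
      (Finsupp.linearIndependent_single_one k _)
  exact (hsingle.map' (torusToFunctionFieldₐ k Δ).toLinearMap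
    (LinearMap.ker_eq_bot.2 torusToFunctionField_injective)).comp
      (fun u => ⟨u, mem_dualMonoid_bot u⟩) fun u w h => congrArg Subtype.val h

variable {D : WeilDivisor (toricVariety k Δ)}

lemma mem_polyhedronPoints_iff (hD : IsSupportedOnBoundary D) {u : DualLattice N} :
    u ∈ polyhedronPoints D ↔ ∀ Z : PrimeDivisor (toricVariety k Δ),
      0 ≤ (toricVariety k Δ).ord (character k Δ u) Z.1 + D Z := by
  rw [forall_primeDivisor_iff fun Z hZ => by rw [ord_character_of_mem_torus hZ, hD Z hZ, add_zero]]
  simp only [ord_character_rayDivisor]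
  rfl

theorem span_character_eq_globalSections (hD : IsSupportedOnBoundary D) :
    Submodule.span k (Set.range fun u : polyhedronPoints D => character k Δ u) =
      globalSections D := by
  refine le_antisymm (Submodule.span_le.2 ?_) fun f hf => ?_
  · rintro _ ⟨u, rfl⟩
    exact mem_globalSections.2 (Or.inr ((mem_polyhedronPoints_iff hD).1 u.2))
  · obtain rfl | hf := mem_globalSections.1 hf
    · exact zero_mem _
    obtain ⟨r, rfl⟩ := exists_torusToFunctionField_eq (f := f) fun Z hZ => by
      simpa only [hD Z hZ, add_zero] using hf Z
    have hmem {u : dualMonoid Δ.zeroCone.1} (hu : r.coeff u ≠ 0) : u.1 ∈ polyhedronPoints D :=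
      fun ρ => (hf (rayDivisor k ρ)).trans (by gcongr; exact ord_torusToFunctionField_le ρ hu)
    have hsum : torusToFunctionField k Δ r = r.coeff.sum fun u c => c • character k Δ u := by
      conv_lhs => rw [← AddMonoidAlgebra.sum_coeff_single r]
      refine (map_finsuppSum (torusToFunctionFieldₐ k Δ) _ _).trans
        (Finsupp.sum_congr fun u _ => ?_)
      rw [← mul_one (r.coeff u), ← AddMonoidAlgebra.smul_single', map_smul, mul_one]
      rfl
    rw [hsum]
    exact Submodule.sum_mem _ fun u hu => Submodule.smul_mem _ _
      (Submodule.subset_span ⟨⟨u, hmem (Finsupp.mem_support_iff.1 hu)⟩, rfl⟩)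

/-- The basis of `H⁰(X, 𝒪(D))` given by the characters in the polyhedron of `D`. -/
def globalSectionsBasis (hD : IsSupportedOnBoundary D) :
    Module.Basis (polyhedronPoints D) k (globalSections D) :=
  (Module.Basis.span (linearIndependent_character.comp _ Subtype.val_injective)).map
    (LinearEquiv.ofEq _ _ (span_character_eq_globalSections hD))

lemma globalSectionsBasis_apply (hD : IsSupportedOnBoundary D) (u : polyhedronPoints D)
    (hu : character k Δ u ∈ globalSections D) :
    globalSectionsBasis hD u = ⟨character k Δ u, hu⟩ := by
  refine Subtype.ext ?_
  rw [globalSectionsBasis, Module.Basis.map_apply, LinearEquiv.coe_ofEq_apply,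
    Module.Basis.span_apply]
  rfl

end GlobalSections

end Toric

end

open AlgebraicGeometry Toric in
theorem mainTheorem2_general {k : Type*} [Field k]
    {N : Type} [AddCommGroup N] [Module.Free ℤ N] [Module.Finite ℤ N]
    (Δ : Fan N) (hΔ : Δ.IsNondegenerate)
    (D : WeilDivisor (toricVariety k Δ)) (hD : IsSupportedOnBoundary D) :
    ∃! e : globalSections D ≃ₗ[k]
        coxGradedPiece (QuotientAddGroup.mk D : DivisorClassGroup (toricVariety k Δ)),
      ∀ (u : DualLattice N)
        (hu : ∀ Z : PrimeDivisor (toricVariety k Δ),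
          0 ≤ (toricVariety k Δ).ord (character k Δ u) Z.1 + D Z),
        (∀ ρ : Δ.Ray, 0 ≤ u ρ.gen + D (rayDivisor k ρ)) ∧
        (e ⟨character k Δ u, mem_globalSections.2 (Or.inr hu)⟩ : CoxRing k Δ) =
          ∏ ρ : Δ.Ray, MvPolynomial.X ρ ^ (u ρ.gen + D (rayDivisor k ρ)).toNat := by
  refine ⟨(globalSectionsBasis hD).equiv (coxGradedPieceBasis hΔ hD) (Equiv.refl _),
    fun u hu => ?_, fun e he => ?_⟩
  · have hmem : u ∈ polyhedronPoints D := (mem_polyhedronPoints_iff hD).2 hu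
    refine ⟨hmem, ?_⟩
    rw [← globalSectionsBasis_apply hD ⟨u, hmem⟩, Module.Basis.equiv_apply, Equiv.refl_apply,
      coxGradedPieceBasis_apply]
  · refine LinearEquiv.toLinearMap_injective ((globalSectionsBasis hD).ext fun u => Subtype.ext ?_)
    have heu := (he u ((mem_polyhedronPoints_iff hD).1 u.2)).2
    rw [← globalSectionsBasis_apply hD u] at heu
    rw [LinearEquiv.coe_coe, LinearEquiv.coe_coe, heu, Module.Basis.equiv_apply, Equiv.refl_apply,
      coxGradedPieceBasis_apply]

open AlgebraicGeometry Toric in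
theorem mainTheorem2 {k : Type*} [Field k] [IsAlgClosed k]
    {N : Type} [AddCommGroup N] [Module.Free ℤ N] [Module.Finite ℤ N]
    (Δ : Fan N) (hΔ : Δ.IsNondegenerate)
    (D : WeilDivisor (toricVariety k Δ)) (hD : IsTorusInvariant D) :
    ∃! e : globalSections D ≃ₗ[k]
        coxGradedPiece (QuotientAddGroup.mk D : DivisorClassGroup (toricVariety k Δ)),
      ∀ (u : DualLattice N)
        (hu : ∀ Z : PrimeDivisor (toricVariety k Δ),
          0 ≤ (toricVariety k Δ).ord (character k Δ u) Z.1 + D Z),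
        (∀ ρ : Δ.Ray, 0 ≤ u ρ.gen + D (rayDivisor k ρ)) ∧
        (e ⟨character k Δ u, mem_globalSections.2 (Or.inr hu)⟩ : CoxRing k Δ) =
          ∏ ρ : Δ.Ray, MvPolynomial.X ρ ^ (u ρ.gen + D (rayDivisor k ρ)).toNat := by
  exact mainTheorem2_general Δ hΔ D hD.isSupportedOnBoundary
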